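/- Let $\mathbb H^3_1=\{(z^1,z^2)\in\mathbb C^2 : |z^1|^2-|z^2|^2=1\}$, identified with $SU(1,1)$ by $(z^1,z^2)\mapsto\begin{pmatrix} z^1&z^2\\ \bar z^2&\bar z^1\end{pmatrix}$, with base point $o=(1,0)$ (the identity matrix). Let $$X_0=\begin{pmatrix} i&0\\0&-i\end{pmatrix},\quad X_1=\begin{pmatrix}0&1\\1&0\end{pmatrix},\quad X_2=\begin{pmatrix}0&i\\-i&0\end{pmatrix}\in\mathfrak{su}(1,1)$$ be regarded as left-invariant vector fields, let $\theta^0,\theta^1,\theta^2$ be the dual left-invariant coframe, write $\theta^\alpha\wedge\theta^\beta=\theta^\alpha\otimes\theta^\beta-\theta^\beta\otimes\theta^\alpha$, and put $$g=g_{\lambda\mu\nu}=\lambda\,\theta^0\otimes\theta^0+\mu\,\theta^1\otimes\theta^1+\nu\,\theta^2\otimes\theta^2,\qquad \mu,\nu>0,\quad -\lambda=\nu\neq\mu .$$ Let $\nabla$ be the Levi-Civita connection of $g$. For $t\in\mathbb R$ let $S=S_\mu(t)$ be the $(0,3)$-tensor field $$S_\mu(t)=\mu\,\theta^2\otimes\theta^0\wedge\theta^1+\mu\,\theta^0\otimes\theta^1\wedge\theta^2+t\,\theta^1\otimes\theta^2\wedge\theta^0,$$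 and also the $(1,2)$-tensor field given by $g(S_XY,Z)=S(X,Y,Z)$; put $\widetilde\nabla=\nabla-S$, with curvature $\widetilde R(X,Y)=[\widetilde\nabla_X,\widetilde\nabla_Y]-\widetilde\nabla_{[X,Y]}$. Let $G$ be a Lie group with Lie algebra $\mathfrak g$ acting smoothly on $\mathbb H^3_1$ by isometries of $g$, with isotropy group $H$ at $o$; for $\xi\in\mathfrak g$ let $\xi^*$ be the vector field generated by $s\mapsto\exp(s\xi)$. A reductive decomposition is a direct sum $\mathfrak g=\mathfrak h\oplus\mathfrak m$, where $\mathfrak h$ is the Lie algebra of $H$ and $\mathrm{Ad}_h\mathfrak m\subset\mathfrak m$ for all $h\in H$. We say that the decomposition and $S$ induce each other if 1. $\widetilde\nabla$ is $G$-invariant and $\widetilde\nabla_{\xi^*}\eta^*|_o=-([\xi,\eta]_{\mathfrak m})^*|_o$ for all $\xi,\eta\in\mathfrak m$; and 2. with $\widetilde{\mathfrak h}\subset\mathrm{End}(T_o\mathbb H^3_1)$ the Lie algebra generated by the operators $\widetilde R(x,y)$, $x,y\in T_o\mathbb H^3_1$, there is a linear isomorphism from $\widetilde{\mathfrak h}\oplus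 T_o\mathbb H^3_1$ with the brackets $[U,V]=UV-VU$, $[U,x]=U(x)$, $[x,y]=S_xy-S_yx-\widetilde R(x,y)$ onto $\mathfrak g$ which preserves brackets, maps $\widetilde{\mathfrak h}$ onto $\mathfrak h$, and maps $T_o\mathbb H^3_1$ onto $\mathfrak m$ as the inverse of $\mathfrak m\ni\xi\mapsto\xi^*|_o$. **Theorem.** $S_\mu(t)$ is a homogeneous pseudo-Riemannian structure on $(\mathbb H^3_1,g)$, that is, $\widetilde\nabla g=0$, $\widetilde\nabla R=0$ (with $R$ the curvature of $\nabla$) and $\widetilde\nabla S=0$. Moreover: (a) If $t\neq 2\nu-\mu$, the group $SU(1,1)\times\mathbb R$ acts smoothly, transitively and effectively by isometries of $g$ on $\mathbb H^3_1$ via $$\bigl((A_0,s),Z\bigr)\longmapsto A_0\,Z\begin{pmatrix}\cosh s&-\sinh s\\-\sinh s&\cosh s\end{pmatrix}.$$ With $D$ the generator of the central factor $\mathbb R$ (so that $\exp(sD)$ is $(I,s)$), the subspaces $$\mathfrak h=\mathrm{span}_{\mathbb R}\{X_1+D\},\qquad \mathfrak m=\mathrm{span}_{\mathbb R}\Bigl\{X_0,\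 \tfrac{\mu+t}{2\nu}X_1-\tfrac{2\nu-\mu-t}{2\nu}D,\ X_2\Bigr\}$$ form a reductive decomposition $\mathfrak{su}(1,1)\oplus\mathbb R=\mathfrak h\oplus\mathfrak m$, and this decomposition and $S_\mu(t)$ induce each other. (b) If $t=2\nu-\mu$, the group $SU(1,1)$ acts smoothly, transitively and effectively by isometries of $g$ on $\mathbb H^3_1$ by left multiplication, with the trivial reductive decomposition $\mathfrak h=0$, $\mathfrak m=\mathfrak{su}(1,1)$, and this decomposition and $S_\mu(t)$ induce each other. -/

import Mathlib

open scoped ContDiff Matrix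

attribute [local instance 100] LieRing.ofAssociativeRing

noncomputable section

namespace AdS3

/-! ### The hypersurface and its smooth functions and vector fields -/

/-- The symmetric bilinear form of signature `(2,2)` on `ℂ × ℂ` whose quadratic form is
`|z¹|² - |z²|²` (the negative of the standard metric of `ℝ^{2,2}`). -/
def ambientForm (z v : ℂ × ℂ) : ℝ :=
  (starRingEnd ℂ z.1 * v.1).re - (starRingEnd ℂ z.2 * v.2).re

/-- Anti-de Sitter space as the hypersurface `|z¹|² - |z²|² = 1` of `ℂ²`. -/
def H31 : Set (ℂ × ℂ) := {z | ‖z.1‖ ^ 2 - ‖z.2‖ ^ 2 = 1}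

/-- The base point `o = (1, 0)`. -/
def base : H31 := ⟨(1, 0), by simp [H31]⟩

/-- The tangent space of the hypersurface at `p`, a real subspace of `ℂ²`. -/
def tangent (p : H31) : Submodule ℝ (ℂ × ℂ) where
  carrier := {v | ambientForm p v = 0}
  add_mem' := by
    intro a b ha hb
    simp only [ambientForm, Set.mem_ofPred_eq, Prod.fst_add, Prod.snd_add, mul_add,
      Complex.add_re] at *
    linarith
  zero_mem' := by simp [ambientForm]
  smul_mem' := by
    intro c a ha
    simp only [ambientForm, Set.mem_ofPred_eq, Prod.smul_fst, Prod.smul_snd,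
      mul_smul_comm, Complex.smul_re, smul_eq_mul] at *
    rw [← mul_sub, ha, mul_zero]

/-- Extension by zero of a map on the hypersurface, so that the `...Within` calculus on the set
`H31` applies.  Only the values on `H31` matter below. -/
def ext0 {F : Type*} [Zero F] (f : H31 → F) : ℂ × ℂ → F :=
  Function.extend Subtype.val f 0

lemma ext0_apply {F : Type*} [Zero F] (f : H31 → F) (p : H31) : ext0 f p = f p :=
  Subtype.val_injective.extend_apply f 0 p

/-- Smoothness of a map on the hypersurface: locally the restriction of a smooth map of `ℂ²`. -/
def IsSmooth {F : Type*} [NormedAddCommGroup F] [NormedSpace ℝ F] (f : H31 → F) : Prop :=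
  ContDiffOn ℝ ∞ (ext0 f) H31

/-- The differential of a map on the hypersurface; it is used on tangent vectors only, where it
does not depend on any choice. -/
def diff {F : Type*} [NormedAddCommGroup F] [NormedSpace ℝ F] (f : H31 → F) (p : H31)
    (v : ℂ × ℂ) : F :=
  fderivWithin ℝ (ext0 f) H31 p v

lemma isSmooth_congr {F : Type*} [NormedAddCommGroup F] [NormedSpace ℝ F] {f : H31 → F}
    {h : ℂ × ℂ → F} (hh : ContDiffOn ℝ ∞ h H31) (e : ∀ p : H31, f p = h p) : IsSmooth f :=
  hh.congr fun x hx => by rw [← e ⟨x, hx⟩]; exact ext0_apply f ⟨x, hx⟩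

/-- The algebra of smooth real functions on the hypersurface. -/
def SmoothFun : Subalgebra ℝ (H31 → ℝ) where
  carrier := {f | IsSmooth f}
  add_mem' := fun {f k} hf hk => isSmooth_congr (ContDiffOn.add hf hk) fun p => by
    simp [ext0_apply]
  mul_mem' := fun {f k} hf hk => isSmooth_congr (ContDiffOn.mul hf hk) fun p => by
    simp [ext0_apply]
  algebraMap_mem' := fun r => isSmooth_congr (h := fun _ => r) contDiffOn_const fun p => rfl

/-- The module of smooth tangent vector fields on the hypersurface. -/
def VecField : Submodule SmoothFun (H31 → ℂ × ℂ) where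
  carrier := {V | IsSmooth V ∧ ∀ p, V p ∈ tangent p}
  add_mem' := fun {V W} hV hW => ⟨isSmooth_congr (ContDiffOn.add hV.1 hW.1) fun p => by
    simp [ext0_apply], fun p => add_mem (hV.2 p) (hW.2 p)⟩
  zero_mem' := ⟨isSmooth_congr (h := fun _ => 0) contDiffOn_const fun p => rfl,
    fun p => zero_mem _⟩
  smul_mem' := fun f V hV => ⟨isSmooth_congr (ContDiffOn.smul f.2 hV.1) fun p => by
      change _ = ext0 f.1 p • ext0 V p
      rw [ext0_apply, ext0_apply]; rfl,
    fun p => Submodule.smul_mem (tangent p) (f.1 p) (hV.2 p)⟩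

instance : AddCommGroup VecField := VecField.addCommGroup

instance : Module SmoothFun VecField := VecField.module

instance : SMul SmoothFun VecField := VecField.module.toDistribMulAction.toMulAction.toSMul

/-- The value at `p` of a vector field, as a tangent vector. -/
def valueAt (p : H31) (V : VecField) : tangent p := ⟨V.1 p, V.2.2 p⟩

/-! ### The Lie bracket of vector fields

The retraction of the cone `|z¹| > |z²|` onto the hypersurface serves only to check that the
bracket of two smooth tangent fields is again a smooth tangent field. -/

/-- The quadratic form `|z¹|² - |z²|²`. -/
def quad (z : ℂ × ℂ) : ℝ := ambientForm z z

lemma quad_eq (z : ℂ × ℂ) : quad z = ‖z.1‖ ^ 2 - ‖z.2‖ ^ 2 := by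
  simp only [quad, ambientForm, ← Complex.normSq_eq_norm_sq, Complex.normSq_apply,
    Complex.mul_re, Complex.conj_re, Complex.conj_im]
  ring

lemma ambientForm_eq (z v : ℂ × ℂ) : ambientForm z v =
    (z.1.re * v.1.re + z.1.im * v.1.im) - (z.2.re * v.2.re + z.2.im * v.2.im) := by
  simp only [ambientForm, Complex.mul_re, Complex.conj_re, Complex.conj_im]
  ring

/-- The ambient form as a continuous bilinear map. -/
def formL : (ℂ × ℂ) →L[ℝ] (ℂ × ℂ) →L[ℝ] ℝ :=
  LinearMap.toContinuousLinearMap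
    { toFun := fun z => LinearMap.toContinuousLinearMap
        { toFun := fun v => ambientForm z v
          map_add' := by intros; simp [ambientForm_eq]; ring
          map_smul' := by intros; simp [ambientForm_eq]; ring }
      map_add' := by intros; ext v <;> simp [ambientForm_eq] <;> ring
      map_smul' := by intros; ext v <;> simp [ambientForm_eq] <;> ring }

@[simp] lemma formL_apply (z v : ℂ × ℂ) : formL z v = ambientForm z v := rfl

/-- The open cone around the hypersurface. -/
def cone : Set (ℂ × ℂ) := {z | 0 < quad z}

/-- The radial retraction of the cone onto the hypersurface. -/
def retr (z : ℂ × ℂ) : ℂ × ℂ := (Real.sqrt (quad z))⁻¹ • z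

lemma contDiff_quad : ContDiff ℝ ∞ quad := by
  have : quad = fun z => formL z z := rfl
  rw [this]; fun_prop

lemma isOpen_cone : IsOpen cone :=
  isOpen_lt continuous_const contDiff_quad.continuous

lemma mem_H31_iff (z : ℂ × ℂ) : z ∈ H31 ↔ quad z = 1 := by rw [quad_eq]; rfl

lemma H31_subset_cone : H31 ⊆ cone := fun z hz => by
  rw [mem_H31_iff] at hz; simp [cone, hz]

lemma retr_mem {z : ℂ × ℂ} (hz : z ∈ cone) : retr z ∈ H31 := by
  have hz' : 0 < quad z := hz
  have hs := Real.sq_sqrt hz'.le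
  have hs0 : Real.sqrt (quad z) ≠ 0 := (Real.sqrt_pos.2 hz').ne'
  rw [mem_H31_iff]
  have : quad (retr z) = ((Real.sqrt (quad z))⁻¹) ^ 2 * quad z := by
    simp only [retr, quad, ambientForm_eq]; simp; ring
  rw [this, inv_pow, hs]; exact inv_mul_cancel₀ hz'.ne'

lemma retr_of_mem {z : ℂ × ℂ} (hz : z ∈ H31) : retr z = z := by
  rw [mem_H31_iff] at hz; simp [retr, hz]

lemma contDiffOn_retr : ContDiffOn ℝ ∞ retr cone := by
  intro z hz
  have hz' : 0 < quad z := hz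
  refine ContDiffAt.contDiffWithinAt ?_
  have h1 : ContDiffAt ℝ ∞ (fun z => Real.sqrt (quad z)) z :=
    (Real.contDiffAt_sqrt hz'.ne').comp z contDiff_quad.contDiffAt
  exact (h1.inv (Real.sqrt_pos.2 hz').ne').smul contDiffAt_id

lemma fderiv_retr (p : H31) {v : ℂ × ℂ} (hv : v ∈ tangent p) : fderiv ℝ retr p v = v := by
  have hp : quad p = 1 := (mem_H31_iff _).1 p.2
  have hq : HasFDerivAt quad (formL.flip p.1 + formL p.1) p.1 := by
    have : quad = fun z => formL z z := rfl
    rw [this]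
    have h := (formL.hasFDerivAt (x := p.1)).clm_apply (hasFDerivAt_id p.1)
    refine HasFDerivAt.congr_fderiv h ?_
    ext <;> simp [add_comm]
  have h0 : (formL.flip p.1 + formL p.1) v = 0 := by
    have : ambientForm p v = 0 := hv
    have h2 : ambientForm v p = ambientForm p v := by simp only [ambientForm_eq]; ring
    simp [this, h2]
  have hs := (hasDerivAt_inv (𝕜 := ℝ) (x := Real.sqrt (quad p)) (by rw [hp]; simp)).comp_hasFDerivAt
    p.1 (hq.sqrt (by rw [hp]; norm_num))
  have := hs.smul (hasFDerivAt_id p.1)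
  have e : retr = (fun z => (Real.sqrt (quad z))⁻¹) • id := rfl
  have h3 := HasFDerivAt.fderiv this
  rw [e]
  erw [h3]
  have h0' : (formL.flip p.1) v + (formL p.1) v = 0 := h0
  have h4 : ambientForm v p + ambientForm p v = 0 := h0'
  simp [hp]
  left
  linarith

/-- The extension of a map to the cone, constant along rays. -/
def hat {F : Type*} [Zero F] (f : H31 → F) : ℂ × ℂ → F := fun z => ext0 f (retr z)

lemma hat_apply {F : Type*} [Zero F] (f : H31 → F) (p : H31) : hat f p = f p := by
  rw [hat, retr_of_mem p.2, ext0_apply]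

lemma contDiffOn_hat {F : Type*} [NormedAddCommGroup F] [NormedSpace ℝ F] {f : H31 → F}
    (hf : IsSmooth f) : ContDiffOn ℝ ∞ (hat f) cone :=
  ContDiffOn.comp hf contDiffOn_retr fun _ hz => retr_mem hz

lemma diff_eq_hat {F : Type*} [NormedAddCommGroup F] [NormedSpace ℝ F] {f : H31 → F}
    (hf : IsSmooth f) (p : H31) {v : ℂ × ℂ} (hv : v ∈ tangent p) :
    diff f p v = fderiv ℝ (hat f) p v := by
  have hd : DifferentiableWithinAt ℝ (ext0 f) H31 (p : ℂ × ℂ) :=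
    (hf.differentiableOn (by simp)) p p.2
  have h1 := hd.hasFDerivWithinAt
  have hc : (p : ℂ × ℂ) ∈ cone := H31_subset_cone p.2
  have hr : HasFDerivAt retr (fderiv ℝ retr p) (p : ℂ × ℂ) :=
    ((contDiffOn_retr.contDiffAt (isOpen_cone.mem_nhds hc)).differentiableAt (by simp)).hasFDerivAt
  have h1' : HasFDerivWithinAt (ext0 f) (fderivWithin ℝ (ext0 f) H31 p) H31 (retr p) := by
    rw [retr_of_mem p.2]; exact h1
  have h2 := (h1'.comp (p : ℂ × ℂ) (hr.hasFDerivWithinAt (s := cone))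
    fun _ hz => retr_mem hz).hasFDerivAt (isOpen_cone.mem_nhds hc)
  have h3 : fderiv ℝ (hat f) p = _ := h2.fderiv
  rw [h3, diff, ContinuousLinearMap.comp_apply, fderiv_retr p hv]

lemma form_hat (W : VecField) {z : ℂ × ℂ} (hz : z ∈ cone) : ambientForm z (hat W.1 z) = 0 := by
  have h := W.2.2 ⟨retr z, retr_mem hz⟩
  have h' : ambientForm (retr z) (W.1 ⟨retr z, retr_mem hz⟩) = 0 := h
  have e : hat W.1 z = W.1 ⟨retr z, retr_mem hz⟩ := ext0_apply W.1 ⟨retr z, retr_mem hz⟩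
  rw [← e] at h'
  have hs0 : Real.sqrt (quad z) ≠ 0 := (Real.sqrt_pos.2 hz).ne'
  have h2 : ambientForm (retr z) (hat W.1 z)
      = (Real.sqrt (quad z))⁻¹ * ambientForm z (hat W.1 z) := by
    simp only [retr, ambientForm_eq]; simp; ring
  rw [h2] at h'
  exact (mul_eq_zero.1 h').resolve_left (inv_ne_zero hs0)

lemma form_deriv (V W : VecField) (p : H31) :
    ambientForm (V.1 p) (W.1 p) + ambientForm p (diff W.1 p (V.1 p)) = 0 := by
  have hc : (p : ℂ × ℂ) ∈ cone := H31_subset_cone p.2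
  have hW : HasFDerivAt (hat W.1) (fderiv ℝ (hat W.1) p) (p : ℂ × ℂ) :=
    (((contDiffOn_hat W.2.1).contDiffAt (isOpen_cone.mem_nhds hc)).differentiableAt
      (by simp)).hasFDerivAt
  have h1 := (formL.hasFDerivAt (x := p.1)).clm_apply hW
  have h2 : HasFDerivAt (fun z => formL z (hat W.1 z)) (0 : (ℂ × ℂ) →L[ℝ] ℝ) p.1 := by
    refine (hasFDerivAt_const (0 : ℝ) p.1).congr_of_eventuallyEq ?_
    filter_upwards [isOpen_cone.mem_nhds hc] with z hz
    exact form_hat W hz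
  have h3 := congrArg (fun L : (ℂ × ℂ) →L[ℝ] ℝ => L (V.1 p)) (h1.unique h2)
  rw [diff_eq_hat W.2.1 p (V.2.2 p)]
  simp only [add_apply, ContinuousLinearMap.comp_apply,
    ContinuousLinearMap.flip_apply, zero_apply, formL_apply, hat_apply] at h3
  linarith

/-- The Lie bracket `[V, W] = DW(V) - DV(W)` of vector fields on the hypersurface. -/
def bracket (V W : VecField) : VecField :=
  ⟨fun p => VectorField.lieBracketWithin ℝ (ext0 V.1) (ext0 W.1) H31 p, by
    have key : ∀ p : H31, VectorField.lieBracketWithin ℝ (ext0 V.1) (ext0 W.1) H31 p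
        = diff W.1 p (V.1 p) - diff V.1 p (W.1 p) := fun p => by
      simp only [VectorField.lieBracketWithin, ext0_apply, diff]
    constructor
    · have hV := contDiffOn_hat V.2.1
      have hW := contDiffOn_hat W.2.1
      have hs : ContDiffOn ℝ ∞ (fun z => fderiv ℝ (hat W.1) z (hat V.1 z)
          - fderiv ℝ (hat V.1) z (hat W.1 z)) cone :=
        ((hW.fderiv_of_isOpen isOpen_cone (by simp)).clm_apply hV).sub
          ((hV.fderiv_of_isOpen isOpen_cone (by simp)).clm_apply hW)
      refine isSmooth_congr (hs.mono H31_subset_cone) fun p => ?_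
      rw [key, diff_eq_hat W.2.1 p (V.2.2 p), diff_eq_hat V.2.1 p (W.2.2 p), hat_apply,
        hat_apply]
    · intro p
      have e : ambientForm (V.1 p) (W.1 p) = ambientForm (W.1 p) (V.1 p) := by
        simp only [ambientForm_eq]; ring
      have h1 := form_deriv V W p
      have h2 := form_deriv W V p
      change formL p.1 (VectorField.lieBracketWithin ℝ (ext0 V.1) (ext0 W.1) H31 p) = 0
      rw [key]
      rw [map_sub, formL_apply, formL_apply]
      linarith⟩

/-! ### Connections, tensors, homogeneous structures -/

/-- A metric tensor (or any field of bilinear forms), evaluated on pairs of tangent vectors. -/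
abbrev FormField := H31 → ℂ × ℂ → ℂ × ℂ → ℝ

/-- A tensor field of type `(1,2)`, written `S X Y = S_X Y`. -/
abbrev Tensor12 := VecField →ₗ[SmoothFun] VecField →ₗ[SmoothFun] VecField

/-- An affine connection: `∇_X Y` is `C^∞`-linear in `X`, and a derivation in `Y`. -/
structure AffineConnection where
  cov : VecField →ₗ[SmoothFun] (VecField → VecField)
  cov_add : ∀ X Y Z : VecField, cov X (Y + Z) = cov X Y + cov X Z
  leibniz : ∀ (X : VecField) (f : SmoothFun) (Y : VecField) (p : H31),
    (cov X (f • Y)).1 p = (diff f.1 p (X.1 p)) • Y.1 p + f.1 p • (cov X Y).1 p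

/-- `D g = 0` for an operator `D X Y = D_X Y`. -/
def MetricParallel (g : FormField) (D : VecField → VecField → VecField) : Prop :=
  ∀ (X Y Z : VecField) (p : H31),
    diff (fun q => g q (Y.1 q) (Z.1 q)) p (X.1 p)
      = g p ((D X Y).1 p) (Z.1 p) + g p (Y.1 p) ((D X Z).1 p)

/-- `nabla` is the Levi-Civita connection of `g`: metric and torsion free. -/
def IsLeviCivita (g : FormField) (nabla : AffineConnection) : Prop :=
  MetricParallel g (fun X Y => nabla.cov X Y) ∧
    ∀ X Y : VecField, nabla.cov X Y - nabla.cov Y X = bracket X Y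

/-- The curvature `R(X,Y)Z = D_X D_Y Z - D_Y D_X Z - D_[X,Y] Z`. -/
def curvature (D : VecField → VecField → VecField) (X Y Z : VecField) : VecField :=
  D X (D Y Z) - D Y (D X Z) - D (bracket X Y) Z

/-- The canonical connection `∇ - S`. -/
def canonical (nabla : AffineConnection) (S : Tensor12) (X Y : VecField) : VecField :=
  nabla.cov X Y - S X Y

/-- Homogeneous pseudo-Riemannian structure: for `D = ∇ - S`, one has
`D g = 0`, `D R = 0` (`R` the curvature of `∇`) and `D S = 0`. -/
def IsHomogeneousStructure (g : FormField) (nabla : AffineConnection) (S : Tensor12) : Prop :=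
  let D := canonical nabla S
  let R := curvature (fun X Y => nabla.cov X Y)
  MetricParallel g D ∧
  (∀ X Y Z W : VecField,
    D X (R Y Z W) - R (D X Y) Z W - R Y (D X Z) W - R Y Z (D X W) = 0) ∧
  (∀ X Y Z : VecField, D X (S Y Z) - S (D X Y) Z - S Y (D X Z) = 0)

/-! ### The groups, their Lie algebras and their actions -/

/-- The signature matrix `diag(1,-1)`. -/
def sig : Matrix (Fin 2) (Fin 2) ℂ := !![1, 0; 0, -1]

lemma sig_mul_sig : sig * sig = 1 := by
  ext i j; fin_cases i <;> fin_cases j <;> simp [sig]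

/-- The group `SU(1,1)`. -/
def SU11 : Subgroup (Matrix.SpecialLinearGroup (Fin 2) ℂ) where
  carrier := {A | A.1ᴴ * sig * A.1 = sig}
  one_mem' := by simp
  mul_mem' := by
    intro A B hA hB
    simp only [Set.mem_ofPred_eq, Matrix.SpecialLinearGroup.coe_mul,
      Matrix.conjTranspose_mul] at *
    calc _ = B.1ᴴ * (A.1ᴴ * sig * A.1) * B.1 := by simp only [Matrix.mul_assoc]
      _ = _ := by rw [hA, hB]
  inv_mem' := by
    intro A hA
    simp only [Set.mem_ofPred_eq] at *
    have h1 : A.1 * (A⁻¹).1 = 1 := by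
      rw [← Matrix.SpecialLinearGroup.coe_mul, mul_inv_cancel, Matrix.SpecialLinearGroup.coe_one]
    have h2 : ((A⁻¹).1)ᴴ * A.1ᴴ = 1 := by
      rw [← Matrix.conjTranspose_mul, h1, Matrix.conjTranspose_one]
    calc ((A⁻¹).1)ᴴ * sig * (A⁻¹).1
        = ((A⁻¹).1)ᴴ * (A.1ᴴ * sig * A.1) * (A⁻¹).1 := by rw [hA]
      _ = (((A⁻¹).1)ᴴ * A.1ᴴ) * sig * (A.1 * (A⁻¹).1) := by simp only [Matrix.mul_assoc]
      _ = sig := by rw [h1, h2]; simp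

/-- The matrix with rows `(z¹, z²)` and `(conj z², conj z¹)`. -/
def toMat (z : ℂ × ℂ) : Matrix (Fin 2) (Fin 2) ℂ :=
  !![z.1, z.2; starRingEnd ℂ z.2, starRingEnd ℂ z.1]

lemma toMat_mem {z : ℂ × ℂ} (hz : z ∈ H31) :
    (toMat z).det = 1 ∧ (toMat z)ᴴ * sig * toMat z = sig := by
  have h : (‖z.1‖ ^ 2 - ‖z.2‖ ^ 2 : ℂ) = 1 := by
    have h0 : ‖z.1‖ ^ 2 - ‖z.2‖ ^ 2 = 1 := hz
    exact_mod_cast h0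
  rw [← Complex.mul_conj', ← Complex.mul_conj'] at h
  constructor
  · simp only [toMat, Matrix.det_fin_two_of]; exact h
  · ext i j
    fin_cases i <;> fin_cases j <;>
      simp [toMat, sig, Matrix.mul_apply, Fin.sum_univ_two]
    · linear_combination h
    · ring
    · ring
    · linear_combination -h

/-- A matrix of `SU(1,1)` is determined by its first row. -/
lemma SU11_form (A : SU11) : toMat (A.1.1 0 0, A.1.1 0 1) = A.1.1 := by
  have hA : A.1.1ᴴ * sig * A.1.1 = sig := A.2
  have h1 : A.1.1 * (A.1⁻¹).1 = 1 := by
    rw [← Matrix.SpecialLinearGroup.coe_mul, mul_inv_cancel, Matrix.SpecialLinearGroup.coe_one]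
  have h2 : A.1.1ᴴ * sig = sig * (A.1⁻¹).1 := by
    calc A.1.1ᴴ * sig = A.1.1ᴴ * sig * (A.1.1 * (A.1⁻¹).1) := by rw [h1, mul_one]
      _ = (A.1.1ᴴ * sig * A.1.1) * (A.1⁻¹).1 := by simp only [Matrix.mul_assoc]
      _ = _ := by rw [hA]
  rw [Matrix.SpecialLinearGroup.coe_inv, Matrix.adjugate_fin_two] at h2
  have h00 := congrFun (congrFun h2 0) 0
  have h10 := congrFun (congrFun h2 1) 0
  simp [sig, Matrix.mul_apply, Fin.sum_univ_two] at h00 h10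
  ext i j
  fin_cases i <;> fin_cases j <;> simp [toMat, h00, h10]

/-- The identification of the hypersurface with `SU(1,1)`. -/
def toSU : H31 ≃ SU11 where
  toFun p := ⟨⟨toMat p, (toMat_mem p.2).1⟩, (toMat_mem p.2).2⟩
  invFun A := ⟨(A.1.1 0 0, A.1.1 0 1), by
    have h := A.1.2
    rw [← SU11_form A] at h
    simp only [toMat, Matrix.det_fin_two_of, Complex.mul_conj'] at h
    exact_mod_cast h⟩
  left_inv p := by ext <;> simp [toMat]
  right_inv A := by
    apply Subtype.ext; apply Subtype.ext; exact SU11_form A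

/-- The hyperbolic boost with rows `(cosh s, -sinh s)` and `(-sinh s, cosh s)`. -/
def boost (s : ℝ) : SU11 :=
  toSU ⟨((Real.cosh s : ℂ), (-Real.sinh s : ℂ)), by
    simp [H31, -Complex.ofReal_cosh, -Complex.ofReal_sinh]⟩

lemma boost_coe (s : ℝ) : (boost s).1.1 =
    !![(Real.cosh s : ℂ), (-Real.sinh s : ℂ); (-Real.sinh s : ℂ), (Real.cosh s : ℂ)] := by
  change toMat _ = _
  simp only [toMat, map_neg, Complex.conj_ofReal]

lemma boost_zero : boost 0 = 1 := by
  apply Subtype.ext; apply Subtype.ext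
  rw [boost_coe]
  ext i j; fin_cases i <;> fin_cases j <;> simp

lemma boost_add (s r : ℝ) : boost (s + r) = boost r * boost s := by
  apply Subtype.ext; apply Subtype.ext
  change (boost (s + r)).1.1 = (boost r).1.1 * (boost s).1.1
  rw [boost_coe, boost_coe, boost_coe, Real.cosh_add, Real.sinh_add]
  push_cast
  ext i j
  fin_cases i <;> fin_cases j <;> simp [Matrix.mul_apply, Fin.sum_univ_two] <;> ring

/-- `SU(1,1)` acting from the left. -/
instance leftAction : MulAction SU11 H31 where
  smul A p := toSU.symm (A * toSU p)
  one_smul p := by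
    change toSU.symm (1 * toSU p) = p
    simp
  mul_smul A B p := by
    change toSU.symm (A * B * toSU p) = toSU.symm (A * toSU (toSU.symm (B * toSU p)))
    simp [mul_assoc]

/-- The group `SU(1,1) × ℝ`. -/
abbrev SU11R := SU11 × Multiplicative ℝ

/-- The action `((A, s), Z) ↦ A Z boost(s)` of `SU(1,1) × ℝ`. -/
instance boostAction : MulAction SU11R H31 where
  smul a p := toSU.symm (a.1 * toSU p * boost a.2.toAdd)
  one_smul p := by
    change toSU.symm (1 * toSU p * boost 0) = p
    simp [boost_zero]
  mul_smul a b p := by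
    change toSU.symm (a.1 * b.1 * toSU p * boost (a.2.toAdd + b.2.toAdd)) =
      toSU.symm (a.1 * toSU (toSU.symm (b.1 * toSU p * boost b.2.toAdd)) * boost a.2.toAdd)
    simp [boost_add, mul_assoc]

/-- The Lie algebra `su(1,1)`. -/
def su11 : LieSubalgebra ℝ (Matrix (Fin 2) (Fin 2) ℂ) where
  carrier := {X | X.trace = 0 ∧ Xᴴ * sig + sig * X = 0}
  add_mem' := by
    rintro X Y ⟨h1, h2⟩ ⟨h3, h4⟩
    refine ⟨by simp [h1, h3], ?_⟩
    rw [Matrix.conjTranspose_add, add_mul, mul_add]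
    calc _ = (Xᴴ * sig + sig * X) + (Yᴴ * sig + sig * Y) := by abel
      _ = 0 := by rw [h2, h4, add_zero]
  zero_mem' := by simp
  smul_mem' := by
    rintro c X ⟨h1, h2⟩
    refine ⟨by simp [h1], ?_⟩
    rw [Matrix.conjTranspose_smul, star_trivial, smul_mul_assoc, mul_smul_comm, ← smul_add, h2,
      smul_zero]
  lie_mem' := by
    rintro X Y ⟨-, h2⟩ ⟨-, h4⟩
    refine ⟨by rw [Ring.lie_def, Matrix.trace_sub, Matrix.trace_mul_comm, sub_self], ?_⟩
    have hX : Xᴴ * sig = -(sig * X) := eq_neg_of_add_eq_zero_left h2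
    have hY : Yᴴ * sig = -(sig * Y) := eq_neg_of_add_eq_zero_left h4
    rw [Ring.lie_def, Matrix.conjTranspose_sub, Matrix.conjTranspose_mul,
      Matrix.conjTranspose_mul, sub_mul, Matrix.mul_assoc, Matrix.mul_assoc, hX, hY, mul_neg,
      mul_neg, ← Matrix.mul_assoc, ← Matrix.mul_assoc, hX, hY]
    noncomm_ring

/-- The basis matrices of `su(1,1)`. -/
def X0 : su11 := ⟨!![Complex.I, 0; 0, -Complex.I], by simp [Matrix.trace_fin_two], by
  ext i j; fin_cases i <;> fin_cases j <;> simp [sig, Matrix.mul_apply, Fin.sum_univ_two]⟩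

/-- A basis matrix of `su(1,1)`. -/
def X1 : su11 := ⟨!![0, 1; 1, 0], by simp [Matrix.trace_fin_two], by
  ext i j; fin_cases i <;> fin_cases j <;> simp [sig, Matrix.mul_apply, Fin.sum_univ_two]⟩

/-- A basis matrix of `su(1,1)`. -/
def X2 : su11 := ⟨!![0, Complex.I; -Complex.I, 0], by simp [Matrix.trace_fin_two], by
  ext i j; fin_cases i <;> fin_cases j <;> simp [sig, Matrix.mul_apply, Fin.sum_univ_two]⟩

lemma exp_mem (X : su11) : (NormedSpace.exp X.1).det = 1 ∧
    (NormedSpace.exp X.1)ᴴ * sig * NormedSpace.exp X.1 = sig := by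
  obtain ⟨X, htr, hJ⟩ := X
  have hinv : NormedSpace.exp (-X) * NormedSpace.exp X = 1 := by
    rw [← Matrix.exp_add_of_commute _ _ (Commute.neg_left (Commute.refl X)), neg_add_cancel,
      NormedSpace.exp_zero]
  constructor
  · let K : Matrix (Fin 2) (Fin 2) ℂ := !![0, 1; -1, 0]
    have hK : K * -K = 1 := by
      ext i j; fin_cases i <;> fin_cases j <;> simp [K]
    have hK' : -K * K = 1 := by
      ext i j; fin_cases i <;> fin_cases j <;> simp [K]
    let u : (Matrix (Fin 2) (Fin 2) ℂ)ˣ := ⟨K, -K, hK, hK'⟩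
    have h1 := Matrix.exp_units_conj u Xᵀ
    have h11 : X 1 1 = - X 0 0 := by
      rw [Matrix.trace_fin_two] at htr; linear_combination htr
    have h2 : (u : Matrix (Fin 2) (Fin 2) ℂ) * Xᵀ * (u⁻¹ : (Matrix (Fin 2) (Fin 2) ℂ)ˣ) = -X := by
      change K * Xᵀ * -K = -X
      ext i j
      fin_cases i <;> fin_cases j <;>
        simp [K, Matrix.mul_apply, Matrix.vecMul, dotProduct, Fin.sum_univ_two, h11]
    rw [h2, Matrix.exp_transpose] at h1
    change NormedSpace.exp (-X) = K * (NormedSpace.exp X)ᵀ * -K at h1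
    rw [h1] at hinv
    have h00 := congrFun (congrFun hinv 0) 0
    rw [Matrix.det_fin_two]
    simp [K, Matrix.mul_apply, Matrix.vecMul, dotProduct, Fin.sum_univ_two] at h00
    linear_combination h00
  · let u : (Matrix (Fin 2) (Fin 2) ℂ)ˣ := ⟨sig, sig, sig_mul_sig, sig_mul_sig⟩
    have h1 := Matrix.exp_units_conj u Xᴴ
    have h2 : (u : Matrix (Fin 2) (Fin 2) ℂ) * Xᴴ * (u⁻¹ : (Matrix (Fin 2) (Fin 2) ℂ)ˣ) = -X := by
      change sig * Xᴴ * sig = -X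
      have hX : Xᴴ * sig = -(sig * X) := eq_neg_of_add_eq_zero_left hJ
      rw [Matrix.mul_assoc, hX, mul_neg, ← Matrix.mul_assoc, sig_mul_sig, one_mul]
    rw [h2, Matrix.exp_conjTranspose] at h1
    change NormedSpace.exp (-X) = sig * (NormedSpace.exp X)ᴴ * sig at h1
    change (NormedSpace.exp X)ᴴ * sig * NormedSpace.exp X = sig
    calc (NormedSpace.exp X)ᴴ * sig * NormedSpace.exp X
        = sig * (sig * (NormedSpace.exp X)ᴴ * sig) * NormedSpace.exp X := by
          rw [← Matrix.mul_assoc, ← Matrix.mul_assoc, sig_mul_sig, one_mul]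
      _ = sig := by rw [← h1, Matrix.mul_assoc, hinv, mul_one]

/-- The exponential map of `SU(1,1)`. -/
def expL (X : su11) : SU11 := ⟨⟨NormedSpace.exp X.1, (exp_mem X).1⟩, (exp_mem X).2⟩

/-- The adjoint action of `SU(1,1)`. -/
def AdL (A : SU11) (X : su11) : su11 := ⟨A.1.1 * X.1 * (A⁻¹).1.1, by
  obtain ⟨X, htr, hJ⟩ := X
  have h1 : (A⁻¹).1.1 * A.1.1 = 1 := by
    change ((A.1⁻¹ * A.1 : Matrix.SpecialLinearGroup (Fin 2) ℂ)).1 = 1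
    rw [inv_mul_cancel]; rfl
  have h1' : A.1.1 * (A⁻¹).1.1 = 1 := by
    change ((A.1 * A.1⁻¹ : Matrix.SpecialLinearGroup (Fin 2) ℂ)).1 = 1
    rw [mul_inv_cancel]; rfl
  have hA : A.1.1ᴴ * sig * A.1.1 = sig := A.2
  have hB : (A⁻¹).1.1ᴴ * sig * (A⁻¹).1.1 = sig := (A⁻¹).2
  have hX : Xᴴ * sig = -(sig * X) := eq_neg_of_add_eq_zero_left hJ
  have e1 : sig * A.1.1 = (A⁻¹).1.1ᴴ * sig := by
    calc sig * A.1.1 = (A⁻¹).1.1ᴴ * sig * (A⁻¹).1.1 * A.1.1 := by rw [hB]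
      _ = _ := by rw [Matrix.mul_assoc, h1, mul_one]
  have e2 : A.1.1ᴴ * sig = sig * (A⁻¹).1.1 := by
    calc A.1.1ᴴ * sig = A.1.1ᴴ * sig * A.1.1 * (A⁻¹).1.1 := by rw [Matrix.mul_assoc _ A.1.1, h1', mul_one]
      _ = _ := by rw [hA]
  refine ⟨?_, ?_⟩
  · rw [Matrix.trace_mul_comm, ← Matrix.mul_assoc, h1, one_mul]; exact htr
  · rw [Matrix.conjTranspose_mul, Matrix.conjTranspose_mul]
    calc (A⁻¹).1.1ᴴ * (Xᴴ * A.1.1ᴴ) * sig + sig * (A.1.1 * X * (A⁻¹).1.1)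
        = (A⁻¹).1.1ᴴ * Xᴴ * (A.1.1ᴴ * sig) + (sig * A.1.1) * X * (A⁻¹).1.1 := by
          simp only [Matrix.mul_assoc]
      _ = (A⁻¹).1.1ᴴ * (Xᴴ * sig) * (A⁻¹).1.1 + (A⁻¹).1.1ᴴ * (sig * X) * (A⁻¹).1.1 := by
          rw [e1, e2]; simp only [Matrix.mul_assoc]
      _ = 0 := by rw [hX]; simp⟩

/-- The exponential map `(X, r) ↦ (exp X, r)` of `SU(1,1) × ℝ`. -/
def expR (ξ : su11 × ℝ) : SU11R := (expL ξ.1, Multiplicative.ofAdd ξ.2)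

/-- The adjoint action of `SU(1,1) × ℝ`. -/
def AdR (a : SU11R) (ξ : su11 × ℝ) : su11 × ℝ := (AdL a.1 ξ.1, ξ.2)

/-- The generator of the factor `ℝ` of `su(1,1) ⊕ ℝ`. -/
def D : su11 × ℝ := (0, 1)

/-- An element of `su(1,1)` as an element of `su(1,1) ⊕ ℝ`. -/
def inc (X : su11) : su11 × ℝ := (X, 0)

/-- `SU(1,1)` as a submanifold of `ℂ²`. -/
def coordL (A : SU11) : ℂ × ℂ := toSU.symm A

/-- `SU(1,1) × ℝ` as a submanifold of `ℂ² × ℝ`. -/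
def coordR (a : SU11R) : (ℂ × ℂ) × ℝ := (coordL a.1, a.2.toAdd)

/-! ### Transitive isometric actions, reductive decompositions, induced structures -/

section Actions

variable {G : Type} [Group G] [MulAction G H31]
variable {L : Type} [LieRing L] [LieAlgebra ℝ L]

/-- `G`, embedded as a submanifold by `ι`, acts smoothly: the map `(γ, p) ↦ γ • p` is smooth on
the product submanifold. -/
def SmoothAction {V : Type} [NormedAddCommGroup V] [NormedSpace ℝ V] (ι : G → V) : Prop :=
  ContDiffOn ℝ ∞
    (Function.extend (fun q : G × H31 => (ι q.1, (q.2 : ℂ × ℂ)))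
      (fun q => ((q.1 • q.2 : H31) : ℂ × ℂ)) 0)
    (Set.range fun q : G × H31 => (ι q.1, (q.2 : ℂ × ℂ)))

/-- The transformation of the hypersurface defined by a group element. -/
def act (γ : G) (p : H31) : ℂ × ℂ := ((γ • p : H31) : ℂ × ℂ)

/-- A group element acts as an isometry of `g` (its inverse is then smooth as well, when this
holds for every group element). -/
def ActsByIsometry (g : FormField) (γ : G) : Prop :=
  IsSmooth (act γ) ∧ ∀ p : H31, ∀ v ∈ tangent p, ∀ w ∈ tangent p,
    g (γ • p) (diff (act γ) p v) (diff (act γ) p w) = g p v w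

/-- The fundamental vector field `ξ*` of `ξ`, generated by `s ↦ exp(s ξ)`. -/
def fundamental (Exp : L → G) (ξ : L) (p : H31) : ℂ × ℂ :=
  deriv (fun s : ℝ => ((Exp (s • ξ) • p : H31) : ℂ × ℂ)) 0

/-- `h ⊕ m` is a reductive decomposition at `o`: `h` is the Lie algebra of the isotropy group of
`o`, and `m` is a complement which is invariant under the adjoint action of the isotropy group. -/
def IsReductiveDecomposition (Exp : L → G) (Ad : G → L → L) (o : H31)
    (h m : Submodule ℝ L) : Prop :=
  (∀ ξ : L, ξ ∈ h ↔ ∀ s : ℝ, Exp (s • ξ) ∈ MulAction.stabilizer G o) ∧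
  IsCompl h m ∧
  ∀ γ ∈ MulAction.stabilizer G o, ∀ ξ ∈ m, Ad γ ξ ∈ m

/-- `V'` is the push-forward of `V` by `γ`. -/
def PushesTo (γ : G) (V V' : VecField) : Prop :=
  ∀ p : H31, V'.1 (γ • p) = diff (act γ) p (V.1 p)

/-- `Dc` is the canonical connection of the reductive decomposition `h ⊕ m`: it is `G`-invariant
and `Dc_{ξ*} η* = -([ξ, η]_m)*` at `o` for `ξ, η ∈ m`. -/
def IsCanonicalConnection (Exp : L → G) (o : H31) (h m : Submodule ℝ L)
    (Dc : VecField → VecField → VecField) : Prop :=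
  (∀ (γ : G) (V V' W W' : VecField), PushesTo γ V V' → PushesTo γ W W' →
    PushesTo γ (Dc V W) (Dc V' W')) ∧
  ∀ ξ ∈ m, ∀ η ∈ m, ∃ V W : VecField,
    V.1 = fundamental Exp ξ ∧ W.1 = fundamental Exp η ∧
    ∀ ζ ∈ m, ⁅ξ, η⁆ - ζ ∈ h → (Dc V W).1 o = -fundamental Exp ζ o

end Actions

/-- The endomorphism `u` of the tangent space at `o` is the curvature operator `R(X,Y)` of `Dc`. -/
def IsCurvatureAt (Dc : VecField → VecField → VecField) (o : H31) (X Y : VecField)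
    (u : Module.End ℝ (tangent o)) : Prop :=
  ∀ Z : VecField, u (valueAt o Z) = valueAt o (curvature Dc X Y Z)

/-- The Lie algebra of endomorphisms of the tangent space at `o` generated by the curvature
operators of `Dc` (the holonomy algebra, for a connection with parallel curvature and torsion). -/
def holonomy (Dc : VecField → VecField → VecField) (o : H31) :
    LieSubalgebra ℝ (Module.End ℝ (tangent o)) :=
  LieSubalgebra.lieSpan ℝ _ {u | ∃ X Y : VecField, IsCurvatureAt Dc o X Y u}

/-- The Lie algebra `hol ⊕ T_o` built from a homogeneous structure `S`, with `hol` the holonomy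
algebra of `Dc = ∇ - S`, curvature `R`, and brackets `[U, V] = UV - VU`, `[U, x] = U x`,
`[x, y] = S_x y - S_y x - R(x, y)`, is identified with `L = h ⊕ m` in such a way that `hol`
corresponds to `h`, and `T_o` to `m` through `ξ ↦ ξ*(o)`. -/
def StructureAlgebraIs {G : Type} [Group G] [MulAction G H31]
    {L : Type} [LieRing L] [LieAlgebra ℝ L] (Exp : L → G) (o : H31) (h m : Submodule ℝ L)
    (nabla : AffineConnection) (S : Tensor12) : Prop :=
  let Dc := canonical nabla S
  ∃ Ψ : (holonomy Dc o × tangent o) ≃ₗ[ℝ] L,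
    (∀ ξ : L, ξ ∈ h ↔ ∃ U : holonomy Dc o, Ψ (U, 0) = ξ) ∧
    (∀ ξ : L, ξ ∈ m ↔ ∃ x : tangent o, Ψ (0, x) = ξ) ∧
    (∀ x : tangent o, fundamental Exp (Ψ (0, x)) o = (x : ℂ × ℂ)) ∧
    (∀ U V : holonomy Dc o, ⁅Ψ (U, 0), Ψ (V, 0)⁆ = Ψ (⁅U, V⁆, 0)) ∧
    (∀ (U : holonomy Dc o) (x : tangent o), ⁅Ψ (U, 0), Ψ (0, x)⁆ = Ψ (0, U.1 x)) ∧
    (∀ X Y : VecField, ∃ U : holonomy Dc o, IsCurvatureAt Dc o X Y U.1 ∧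
      ⁅Ψ (0, valueAt o X), Ψ (0, valueAt o Y)⁆ = Ψ (-U, valueAt o (S X Y - S Y X)))

/-! ### Metrics of Kaluza-Klein type -/

/-- The left-invariant vector field of `X ∈ su(1,1)`: the first row of `Z X`. -/
def leftInv (X : su11) (p : H31) : ℂ × ℂ := ((toMat p * X.1) 0 0, (toMat p * X.1) 0 1)

/-- The left-invariant coframe dual to `X0, X1, X2`. -/
def θ (α : Fin 3) (p : H31) (v : ℂ × ℂ) : ℝ :=
  ![(starRingEnd ℂ p.1.1 * v.1 - p.1.2 * starRingEnd ℂ v.2).im,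
    (starRingEnd ℂ p.1.1 * v.2 - p.1.2 * starRingEnd ℂ v.1).re,
    (starRingEnd ℂ p.1.1 * v.2 - p.1.2 * starRingEnd ℂ v.1).im] α

lemma θ_leftInv (α β : Fin 3) (p : H31) :
    θ α p (leftInv (![X0, X1, X2] β) p) = if α = β then 1 else 0 := by
  have hp : quad p = 1 := (mem_H31_iff _).1 p.2
  rw [quad, ambientForm_eq] at hp
  fin_cases α <;> fin_cases β <;>
    simp [θ, leftInv, X0, X1, X2, toMat, Matrix.mul_apply, Fin.sum_univ_two] <;> linarith

lemma leftInv_mem (X : Fin 3) (p : H31) : leftInv (![X0, X1, X2] X) p ∈ tangent p := by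
  change ambientForm _ _ = 0
  rw [ambientForm_eq]
  fin_cases X <;>
    simp [leftInv, X0, X1, X2, toMat, Matrix.mul_apply, Fin.sum_univ_two] <;> ring

/-- The metric `λ θ⁰⊗θ⁰ + μ θ¹⊗θ¹ + ν θ²⊗θ²`. -/
def kkMetric (lam mu nu : ℝ) : FormField := fun p v w =>
  lam * (θ 0 p v * θ 0 p w) + mu * (θ 1 p v * θ 1 p w) + nu * (θ 2 p v * θ 2 p w)

/-- The two-form `θ^α ∧ θ^β = θ^α ⊗ θ^β - θ^β ⊗ θ^α`. -/
def wedge (α β : Fin 3) (p : H31) (v w : ℂ × ℂ) : ℝ :=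
  θ α p v * θ β p w - θ β p v * θ α p w

/-- The `(0,3)`-tensor `μ θ²⊗θ⁰∧θ¹ + μ θ⁰⊗θ¹∧θ² + t θ¹⊗θ²∧θ⁰`. -/
def Smu (mu t : ℝ) (p : H31) (u v w : ℂ × ℂ) : ℝ :=
  mu * (θ 2 p u * wedge 0 1 p v w) + mu * (θ 0 p u * wedge 1 2 p v w)
    + t * (θ 1 p u * wedge 2 0 p v w)

/-- The isotropy algebra, spanned by `X1 + D`. -/
def isotropy : Submodule ℝ (su11 × ℝ) := Submodule.span ℝ {inc X1 + D}

/-- The complement spanned by `X0`, `(μ+t)/(2ν) X1 - (2ν-μ-t)/(2ν) D` and `X2`. -/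
def complement (mu nu t : ℝ) : Submodule ℝ (su11 × ℝ) :=
  Submodule.span ℝ
    {inc X0, ((mu + t) / (2 * nu)) • inc X1 - ((2 * nu - mu - t) / (2 * nu)) • D, inc X2}

end AdS3

end

noncomputable section

namespace AdS3

/-! ### Calculus on the hypersurface -/

/-! Put `α = μ/ν`, `τ = t/ν`, `κ = α + τ - 2`, and let `B` be the infinitesimal boost `X0 ↦ X2`, `X2
↦ X0`, `X1 ↦ 0`. In the left-invariant frame the tensor `S` cancels every coefficient of the
Levi-Civita connection except one multiple of `θ¹`: the canonical connection has connection form `κ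
θ¹ ⊗ B` (`comp_canonD`). Everything follows from this formula together with `ad X1 = -2B`.

A tensor with constant coefficients in the frame is parallel as soon as it is `B`-invariant. The
metric is, because `-λ = ν`; the Lie bracket is, because `ad X1` is a derivation. Hence the
Levi-Civita curvature is too, and so is `S` by its explicit coefficients. This gives the homogeneous
structure (`canonD_isHomogeneousStructure`). The curvature of the canonical connection is `κ dθ¹ ⊗
B` (`comp_curvature_canonD`), so the holonomy algebra is the line `ℝB` when `κ ≠ 0` and zero when `κ
= 0`, that is, when `t = 2ν - μ`.

Left translations fix the coframe. Right multiplication by `boost s` fixes `θ¹` and turns `(θ⁰, θ²)`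
by a hyperbolic angle `2s` (`θ_act`), so it preserves the metric and commutes with `B`; this yields
isometries that preserve the connection (`canonD_pushesTo`). Since `boost s = exp(-s X1)`, the
isotropy algebra is spanned by `X1 + D`.

For `ξ = (X, r)` the field `ξ*` at `p` is `X p - r p X1`. Differentiating at `o`, the connection
gives `-[X, Y]` plus `(κ(x₁ - r) - 2r) B Y`, with `x₁` the `X1`-coordinate of `X`. The vanishing of
the scalar is exactly the equation of `m` (`mem_complement_iff`, `canonD_fundField`). The
isomorphism sends `B` to `-(X1 + D)/2` and lifts a tangent vector at `o` to `m` (`holMap`). If `κ =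
0` the frame is parallel and `-S` has the torsion whose negative is the bracket of `su(1,1)`
(`leftMap`). -/

lemma diff_eq_fderiv {F : Type*} [NormedAddCommGroup F] [NormedSpace ℝ F] {f : H31 → F}
    (hf : IsSmooth f) {h : ℂ × ℂ → F} (p : H31) (hh : DifferentiableAt ℝ h p)
    (e : ∀ q : H31, f q = h q) {v : ℂ × ℂ} (hv : v ∈ tangent p) :
    diff f p v = fderiv ℝ h p v := by
  have hc : (p : ℂ × ℂ) ∈ cone := H31_subset_cone p.2
  have hr : DifferentiableAt ℝ retr (p : ℂ × ℂ) :=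
    (contDiffOn_retr.contDiffAt (isOpen_cone.mem_nhds hc)).differentiableAt (by simp)
  have hh' : DifferentiableAt ℝ h (retr p) := by rwa [retr_of_mem p.2]
  -- Any ambient extension will do: on the cone, `hat f` is `h` composed with the retraction, whose
  -- differential is the identity on tangent vectors.
  have h1 : hat f =ᶠ[nhds (p : ℂ × ℂ)] h ∘ retr := by
    filter_upwards [isOpen_cone.mem_nhds hc] with z hz
    have h2 : hat f z = f ⟨retr z, retr_mem hz⟩ := ext0_apply f ⟨retr z, retr_mem hz⟩
    rw [h2, e]; rfl
  rw [diff_eq_hat hf p hv, h1.fderiv_eq, fderiv_comp _ hh' hr, ContinuousLinearMap.comp_apply,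
    fderiv_retr p hv, retr_of_mem p.2]

lemma differentiableAt_hat {F : Type*} [NormedAddCommGroup F] [NormedSpace ℝ F] {f : H31 → F}
    (hf : IsSmooth f) (p : H31) : DifferentiableAt ℝ (hat f) p :=
  ((contDiffOn_hat hf).contDiffAt (isOpen_cone.mem_nhds (H31_subset_cone p.2))).differentiableAt
    (by simp)

/-- The derivative of a smooth function along a vector field. -/
def der (X : VecField) (f : SmoothFun) : SmoothFun :=
  ⟨fun p => diff f.1 p (X.1 p), by
    have hs : ContDiffOn ℝ ∞ (fun z => fderiv ℝ (hat f.1) z (hat X.1 z)) cone :=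
      ((contDiffOn_hat f.2).fderiv_of_isOpen isOpen_cone (by simp)).clm_apply
        (contDiffOn_hat X.2.1)
    refine isSmooth_congr (hs.mono H31_subset_cone) fun p => ?_
    rw [diff_eq_hat f.2 p (X.2.2 p), hat_apply]⟩

lemma der_apply (X : VecField) (f : SmoothFun) (p : H31) :
    (der X f).1 p = fderiv ℝ (hat f.1) p (X.1 p) :=
  diff_eq_hat f.2 p (X.2.2 p)

lemma SmoothFun.ext' {f k : SmoothFun} (h : ∀ p, f.1 p = k.1 p) : f = k :=
  Subtype.ext (funext h)

lemma der_add (X : VecField) (f k : SmoothFun) : der X (f + k) = der X f + der X k := by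
  refine SmoothFun.ext' fun p => ?_
  have hf := differentiableAt_hat f.2 p
  have hk := differentiableAt_hat k.2 p
  have h := diff_eq_fderiv (f + k).2 (h := hat f.1 + hat k.1) p (hf.add hk)
    (fun q => by rw [Pi.add_apply, hat_apply, hat_apply]; rfl) (X.2.2 p)
  rw [fderiv_add hf hk] at h
  change diff (f + k).1 p (X.1 p) = (der X f).1 p + (der X k).1 p
  rw [h, der_apply, der_apply]; rfl

lemma der_mul (X : VecField) (f k : SmoothFun) : der X (f * k) = der X f * k + f * der X k := by
  refine SmoothFun.ext' fun p => ?_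
  have hf := differentiableAt_hat f.2 p
  have hk := differentiableAt_hat k.2 p
  have h := diff_eq_fderiv (f * k).2 (h := hat f.1 * hat k.1) p (hf.mul hk)
    (fun q => by rw [Pi.mul_apply, hat_apply, hat_apply]; rfl) (X.2.2 p)
  rw [fderiv_mul hf hk] at h
  change diff (f * k).1 p (X.1 p) = (der X f).1 p * k.1 p + f.1 p * (der X k).1 p
  rw [h, der_apply, der_apply]
  simp [hat_apply]; ring

lemma der_algebraMap (X : VecField) (r : ℝ) : der X (algebraMap ℝ SmoothFun r) = 0 := by
  refine SmoothFun.ext' fun p => ?_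
  have h := diff_eq_fderiv (algebraMap ℝ SmoothFun r).2 (h := fun _ => r) p
    (differentiableAt_const r) (fun q => rfl) (X.2.2 p)
  change diff (algebraMap ℝ SmoothFun r).1 p (X.1 p) = 0
  rw [h]; simp

lemma der_neg (X : VecField) (f : SmoothFun) : der X (-f) = -der X f := by
  have h := der_mul X (algebraMap ℝ SmoothFun (-1)) f
  rw [der_algebraMap, map_neg, map_one] at h
  have e : (-1 : SmoothFun) * f = -f := by ring
  rw [e] at h
  rw [h]; ring

lemma der_sub (X : VecField) (f k : SmoothFun) : der X (f - k) = der X f - der X k := by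
  rw [sub_eq_add_neg, der_add, der_neg, sub_eq_add_neg]

lemma der_two (X : VecField) : der X (2 : SmoothFun) = 0 := der_algebraMap X 2

lemma der_three (X : VecField) : der X (3 : SmoothFun) = 0 := der_algebraMap X 3

lemma der_four (X : VecField) : der X (4 : SmoothFun) = 0 := der_algebraMap X 4

lemma der_add_left (X Y : VecField) (f : SmoothFun) : der (X + Y) f = der X f + der Y f := by
  refine SmoothFun.ext' fun p => ?_
  change (der (X + Y) f).1 p = (der X f).1 p + (der Y f).1 p
  rw [der_apply, der_apply, der_apply, ← map_add]; rfl

lemma der_smul_left (k : SmoothFun) (X : VecField) (f : SmoothFun) :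
    der (k • X) f = k * der X f := by
  refine SmoothFun.ext' fun p => ?_
  change (der (k • X) f).1 p = k.1 p * (der X f).1 p
  rw [der_apply, der_apply, ← smul_eq_mul, ← map_smul]; rfl

lemma bracket_apply (V W : VecField) (p : H31) :
    (bracket V W).1 p = diff W.1 p (V.1 p) - diff V.1 p (W.1 p) := by
  simp only [bracket, VectorField.lieBracketWithin, ext0_apply, diff]

/-- The second derivatives of the extension `hat f` cancel by symmetry, leaving its first derivative
along the bracket. In curvature computations this removes all second-order terms. -/
lemma der_bracket (X Y : VecField) (f : SmoothFun) :
    der (bracket X Y) f = der X (der Y f) - der Y (der X f) := by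
  refine SmoothFun.ext' fun p => ?_
  have hc : (p : ℂ × ℂ) ∈ cone := H31_subset_cone p.2
  have hcf : ContDiffAt ℝ ∞ (hat f.1) (p : ℂ × ℂ) :=
    (contDiffOn_hat f.2).contDiffAt (isOpen_cone.mem_nhds hc)
  have hsym : IsSymmSndFDerivAt ℝ (hat f.1) (p : ℂ × ℂ) := hcf.isSymmSndFDerivAt
    (by simp only [minSmoothness_of_isRCLikeNormedField]; exact ENat.LEInfty.out)
  have hdf : DifferentiableAt ℝ (fderiv ℝ (hat f.1)) (p : ℂ × ℂ) :=
    (hcf.fderiv_right (m := 1) (by norm_num; exact ENat.LEInfty.out)).differentiableAt (by simp)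
  have key : ∀ V W : VecField, (der V (der W f)).1 p =
      fderiv ℝ (fderiv ℝ (hat f.1)) p (V.1 p) (W.1 p)
        + fderiv ℝ (hat f.1) p (diff W.1 p (V.1 p)) := fun V W => by
    have hW := differentiableAt_hat W.2.1 p
    have h := diff_eq_fderiv (der W f).2 (h := fun z => fderiv ℝ (hat f.1) z (hat W.1 z)) p
      (hdf.clm_apply hW) (fun q => by rw [der_apply, hat_apply]) (V.2.2 p)
    change diff (der W f).1 p (V.1 p) = _
    rw [h, fderiv_clm_apply hdf hW, diff_eq_hat W.2.1 p (V.2.2 p)]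
    simp [hat_apply, add_comm]
  change (der (bracket X Y) f).1 p = (der X (der Y f)).1 p - (der Y (der X f)).1 p
  rw [der_apply, key, key, bracket_apply, map_sub, hsym.eq]
  ring

lemma diff_comp_linear {f : H31 → ℝ} (hf : IsSmooth f) (T : (ℂ × ℂ) →L[ℝ] (ℂ × ℂ))
    (φ : H31 → H31) (hφ : ∀ q, (φ q : ℂ × ℂ) = T q) (hfφ : IsSmooth (fun q => f (φ q))) (p : H31)
    {v : ℂ × ℂ} (hv : v ∈ tangent p) (hTv : T v ∈ tangent (φ p)) :
    diff (fun q => f (φ q)) p v = diff f (φ p) (T v) := by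
  have h1 : DifferentiableAt ℝ (hat f) (T p) := by
    rw [← hφ]; exact differentiableAt_hat hf (φ p)
  rw [diff_eq_fderiv hfφ (h := fun z => hat f (T z)) p
    (h1.comp (p : ℂ × ℂ) T.differentiableAt) (fun q => by rw [← hφ, hat_apply]) hv,
    diff_eq_hat hf _ hTv]
  have h2 := fderiv_comp (p : ℂ × ℂ) h1 T.differentiableAt
  change fderiv ℝ (hat f ∘ T) p v = _
  rw [h2, hφ]; simp

lemma isSmooth_linear (T : (ℂ × ℂ) →L[ℝ] (ℂ × ℂ)) {f : H31 → ℂ × ℂ} (e : ∀ q : H31, f q = T q) :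
    IsSmooth f := isSmooth_congr T.contDiff.contDiffOn e

lemma diff_linear (T : (ℂ × ℂ) →L[ℝ] (ℂ × ℂ)) {f : H31 → ℂ × ℂ} (e : ∀ q : H31, f q = T q)
    (p : H31) {v : ℂ × ℂ} (hv : v ∈ tangent p) : diff f p v = T v := by
  rw [diff_eq_fderiv (isSmooth_linear T e) p T.differentiableAt e hv, T.fderiv]

/-! ### The product of `ℂ²` and the left-invariant frame -/

/-- The product of `ℂ²` for which `toMat` is multiplicative, as a real bilinear map. -/
def mulL : (ℂ × ℂ) →L[ℝ] (ℂ × ℂ) →L[ℝ] (ℂ × ℂ) :=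
  LinearMap.toContinuousLinearMap
    { toFun := fun z => LinearMap.toContinuousLinearMap
        { toFun := fun w => (z.1 * w.1 + z.2 * starRingEnd ℂ w.2,
            z.1 * w.2 + z.2 * starRingEnd ℂ w.1)
          map_add' := by intros; ext1 <;> simp <;> ring
          map_smul' := by intros; ext1 <;> simp <;> ring }
      map_add' := by intros; refine ContinuousLinearMap.ext fun w => ?_; ext1 <;> simp <;> ring
      map_smul' := by intros; refine ContinuousLinearMap.ext fun w => ?_; ext1 <;> simp <;> ring }

lemma mulL_apply (z w : ℂ × ℂ) : mulL z w =
    (z.1 * w.1 + z.2 * starRingEnd ℂ w.2, z.1 * w.2 + z.2 * starRingEnd ℂ w.1) := rfl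

lemma mulL_assoc (z w u : ℂ × ℂ) : mulL (mulL z w) u = mulL z (mulL w u) := by
  ext1 <;> simp [mulL_apply] <;> ring

lemma mulL_one (z : ℂ × ℂ) : mulL z (1, 0) = z := by simp [mulL_apply]

lemma one_mulL (z : ℂ × ℂ) : mulL (1, 0) z = z := by simp [mulL_apply]

lemma toMat_mulL (z w : ℂ × ℂ) : toMat (mulL z w) = toMat z * toMat w := by
  ext i j
  fin_cases i <;> fin_cases j <;>
    simp [toMat, mulL_apply, Matrix.mul_apply, Fin.sum_univ_two] <;> ring

/-- The inverse for `mulL` of a point of the hypersurface. -/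
def conjInv (z : ℂ × ℂ) : ℂ × ℂ := (starRingEnd ℂ z.1, -z.2)

lemma normSq_sub (p : H31) :
    starRingEnd ℂ p.1.1 * p.1.1 - p.1.2 * starRingEnd ℂ p.1.2 = 1 := by
  have h := (toMat_mem p.2).1
  simp only [toMat, Matrix.det_fin_two_of] at h
  linear_combination h

lemma conjInv_mulL (p : H31) : mulL (conjInv p) p = (1, 0) := by
  have h := normSq_sub p
  ext1 <;> simp [mulL_apply, conjInv]
  · linear_combination h
  · ring

lemma mulL_conjInv (p : H31) : mulL p (conjInv p) = (1, 0) := by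
  have h := normSq_sub p
  ext1 <;> simp [mulL_apply, conjInv]
  · linear_combination h
  · ring

lemma conjInv_mulL_cancel (p : H31) (w : ℂ × ℂ) : mulL (conjInv p) (mulL p w) = w := by
  rw [← mulL_assoc, conjInv_mulL, one_mulL]

lemma mulL_conjInv_cancel (p : H31) (w : ℂ × ℂ) : mulL p (mulL (conjInv p) w) = w := by
  rw [← mulL_assoc, mulL_conjInv, one_mulL]

/-- The coordinates of the imaginary part of an element of `ℂ²`. -/
def imCoord (a : Fin 3) (w : ℂ × ℂ) : ℝ := ![w.1.im, w.2.re, w.2.im] a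

/-- The coframe is the Maurer–Cartan form `p⁻¹ dp` in coordinates, which reduces statements about
`θ` to algebra at the identity. -/
lemma θ_eq (a : Fin 3) (p : H31) (v : ℂ × ℂ) : θ a p v = imCoord a (mulL (conjInv p) v) := by
  fin_cases a <;> simp [θ, imCoord, mulL_apply, conjInv] <;> ring

lemma θ_mulL (a : Fin 3) (p : H31) (w : ℂ × ℂ) : θ a p (mulL p w) = imCoord a w := by
  rw [θ_eq, conjInv_mulL_cancel]

/-- Tangency at `p` thus means that `p⁻¹ v` has zero scalar part. -/
lemma re_conjInv_mulL (z v : ℂ × ℂ) : (mulL (conjInv z) v).1.re = ambientForm z v := by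
  simp [mulL_apply, conjInv, ambientForm]; ring

lemma mulL_mem_tangent (p : H31) {w : ℂ × ℂ} (hw : w.1.re = 0) : mulL p w ∈ tangent p := by
  change ambientForm p (mulL p w) = 0
  rw [← re_conjInv_mulL, conjInv_mulL_cancel, hw]

lemma re_of_mem_tangent {p : H31} {v : ℂ × ℂ} (hv : v ∈ tangent p) :
    (mulL (conjInv p) v).1.re = 0 := by
  rw [re_conjInv_mulL]; exact hv

lemma θ_add (a : Fin 3) (p : H31) (v w : ℂ × ℂ) : θ a p (v + w) = θ a p v + θ a p w := by
  fin_cases a <;> simp [θ] <;> ring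

lemma θ_smul (a : Fin 3) (p : H31) (r : ℝ) (v : ℂ × ℂ) : θ a p (r • v) = r * θ a p v := by
  fin_cases a <;> simp [θ] <;> ring

/-- The first rows of `X0, X1, X2`. -/
def unit (a : Fin 3) : ℂ × ℂ := ![(Complex.I, 0), (0, 1), (0, Complex.I)] a

lemma imCoord_unit (a b : Fin 3) : imCoord a (unit b) = if a = b then 1 else 0 := by
  fin_cases a <;> fin_cases b <;> simp [imCoord, unit]

lemma unit_re (a : Fin 3) : (unit a).1.re = 0 := by fin_cases a <;> simp [unit]

lemma eq_sum_unit {w : ℂ × ℂ} (hw : w.1.re = 0) :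
    w = imCoord 0 w • unit 0 + imCoord 1 w • unit 1 + imCoord 2 w • unit 2 := by
  ext1
  · apply Complex.ext <;> simp [imCoord, unit, hw]
  · apply Complex.ext <;> simp [imCoord, unit]

lemma eq_sum_θ {p : H31} {v : ℂ × ℂ} (hv : v ∈ tangent p) :
    v = θ 0 p v • mulL p (unit 0) + θ 1 p v • mulL p (unit 1) + θ 2 p v • mulL p (unit 2) := by
  simp only [θ_eq, ← map_smul, ← map_add]
  rw [← eq_sum_unit (re_of_mem_tangent hv), mulL_conjInv_cancel]

lemma tangent_ext {p : H31} {v w : ℂ × ℂ} (hv : v ∈ tangent p) (hw : w ∈ tangent p)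
    (h : ∀ a, θ a p v = θ a p w) : v = w := by
  rw [eq_sum_θ hv, eq_sum_θ hw]; simp only [h]

/-- The left-invariant frame. -/
def frame (a : Fin 3) : VecField :=
  ⟨fun p => mulL p (unit a), isSmooth_linear (mulL.flip (unit a)) fun _ => rfl,
    fun p => mulL_mem_tangent p (unit_re a)⟩

/-- The components of a vector field in the left-invariant frame. -/
def comp (a : Fin 3) (V : VecField) : SmoothFun :=
  ⟨fun p => θ a p (V.1 p), by
    have hV : ContDiffOn ℝ ∞ (ext0 V.1) H31 := V.2.1
    have h0 : ContDiff ℝ ∞ conjInv :=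
      ((Complex.conjCLE.contDiff.comp contDiff_fst).prodMk contDiff_snd.neg)
    have h1 : ContDiffOn ℝ ∞ (fun z => mulL (conjInv z) (ext0 V.1 z)) H31 :=
      ((mulL.contDiff.comp h0).contDiffOn).clm_apply hV
    have h2 : ContDiffOn ℝ ∞ (fun z => imCoord a (mulL (conjInv z) (ext0 V.1 z))) H31 := by
      fin_cases a
      · exact Complex.imCLM.contDiff.comp_contDiffOn h1.fst
      · exact Complex.reCLM.contDiff.comp_contDiffOn h1.snd
      · exact Complex.imCLM.contDiff.comp_contDiffOn h1.snd
    exact isSmooth_congr h2 fun p => by rw [ext0_apply, θ_eq]⟩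

lemma comp_apply (a : Fin 3) (V : VecField) (p : H31) : (comp a V).1 p = θ a p (V.1 p) := rfl

lemma VecField.ext_comp {V W : VecField} (h : ∀ a, comp a V = comp a W) : V = W := by
  refine Subtype.ext (funext fun p => tangent_ext (V.2.2 p) (W.2.2 p) fun a => ?_)
  rw [← comp_apply, h, comp_apply]

lemma comp_add (a : Fin 3) (V W : VecField) : comp a (V + W) = comp a V + comp a W :=
  SmoothFun.ext' fun p => θ_add a p (V.1 p) (W.1 p)

lemma comp_smul (a : Fin 3) (f : SmoothFun) (V : VecField) : comp a (f • V) = f * comp a V :=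
  SmoothFun.ext' fun p => θ_smul a p (f.1 p) (V.1 p)

lemma comp_zero (a : Fin 3) : comp a 0 = 0 := by
  have h := comp_smul a 0 0
  rw [smul_zero] at h
  rw [h]; ring

lemma comp_sub (a : Fin 3) (V W : VecField) : comp a (V - W) = comp a V - comp a W := by
  have h := comp_add a (V - W) W
  rw [sub_add_cancel] at h
  rw [h]; ring

lemma comp_frame (a b : Fin 3) : comp a (frame b) = if a = b then 1 else 0 := by
  refine SmoothFun.ext' fun p => ?_
  rw [comp_apply]
  change θ a p (mulL p (unit b)) = _
  rw [θ_mulL, imCoord_unit]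
  split_ifs <;> rfl

/-- The vector field with given components. -/
def ofComp (f : Fin 3 → SmoothFun) : VecField := f 0 • frame 0 + f 1 • frame 1 + f 2 • frame 2

lemma comp_ofComp (a : Fin 3) (f : Fin 3 → SmoothFun) : comp a (ofComp f) = f a := by
  simp only [ofComp, comp_add, comp_smul, comp_frame]
  fin_cases a <;> simp

lemma vecField_apply (V : VecField) (p : H31) :
    V.1 p = (comp 0 V).1 p • mulL p (unit 0) + (comp 1 V).1 p • mulL p (unit 1)
      + (comp 2 V).1 p • mulL p (unit 2) := eq_sum_θ (V.2.2 p)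

/-- Product rule for `V = ∑ fₐ · (p eₐ)`: the coefficients are differentiated, and the linear factor
`p` is replaced by `v`, which multiplies `p⁻¹ V`. -/
lemma diff_vecField (V : VecField) (p : H31) {v : ℂ × ℂ} (hv : v ∈ tangent p) :
    diff V.1 p v = (diff (comp 0 V).1 p v • mulL p (unit 0) + diff (comp 1 V).1 p v • mulL p (unit 1)
      + diff (comp 2 V).1 p v • mulL p (unit 2)) + mulL v (mulL (conjInv p) (V.1 p)) := by
  have hd : ∀ a, HasFDerivAt (fun z => hat (comp a V).1 z • mulL.flip (unit a) z)
      (hat (comp a V).1 p • mulL.flip (unit a)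
        + (fderiv ℝ (hat (comp a V).1) p).smulRight (mulL.flip (unit a) p)) (p : ℂ × ℂ) := fun a =>
    (differentiableAt_hat (comp a V).2 p).hasFDerivAt.smul (mulL.flip (unit a)).hasFDerivAt
  have h := ((hd 0).add (hd 1)).add (hd 2)
  rw [diff_eq_fderiv V.2.1 p h.differentiableAt (fun q => ?_) hv, h.fderiv,
    diff_eq_hat (comp 0 V).2 p hv, diff_eq_hat (comp 1 V).2 p hv, diff_eq_hat (comp 2 V).2 p hv]
  · conv_rhs => rw [vecField_apply V p]
    simp only [map_add, map_smul, conjInv_mulL_cancel]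
    simp only [hat_apply, add_apply, smul_apply, ContinuousLinearMap.smulRight_apply,
      ContinuousLinearMap.flip_apply]
    abel
  · simp only [Pi.add_apply, hat_apply, ContinuousLinearMap.flip_apply]
    exact vecField_apply V q

/-- The terms from the moving frame combine into the commutator of `p⁻¹V` and `p⁻¹W`, whence the
constants of `[X1, X2] = -2 X0`, `[X2, X0] = 2 X1`, `[X0, X1] = 2 X2`. -/
lemma comp_bracket (V W : VecField) :
    comp 0 (bracket V W) = der V (comp 0 W) - der W (comp 0 V)
      - 2 * (comp 1 V * comp 2 W - comp 2 V * comp 1 W) ∧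
    comp 1 (bracket V W) = der V (comp 1 W) - der W (comp 1 V)
      + 2 * (comp 2 V * comp 0 W - comp 0 V * comp 2 W) ∧
    comp 2 (bracket V W) = der V (comp 2 W) - der W (comp 2 V)
      + 2 * (comp 0 V * comp 1 W - comp 1 V * comp 0 W) := by
  have key : ∀ p : H31, (bracket V W).1 p = mulL p (((der V (comp 0 W)).1 p - (der W (comp 0 V)).1 p) • unit 0
      + ((der V (comp 1 W)).1 p - (der W (comp 1 V)).1 p) • unit 1
      + ((der V (comp 2 W)).1 p - (der W (comp 2 V)).1 p) • unit 2
      + (mulL (mulL (conjInv p) (V.1 p)) (mulL (conjInv p) (W.1 p))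
        - mulL (mulL (conjInv p) (W.1 p)) (mulL (conjInv p) (V.1 p)))) := fun p => by
    rw [bracket_apply, diff_vecField V p (W.2.2 p), diff_vecField W p (V.2.2 p)]
    simp only [map_add, map_sub, map_smul, ← mulL_assoc, mulL_conjInv, one_mulL]
    simp only [der, sub_smul]
    abel
  have key' : ∀ p : H31, ∀ a, θ a p ((bracket V W).1 p) = imCoord a _ := fun p a => by
    rw [key p, θ_mulL]
  have hV : ∀ p : H31, mulL (conjInv p) (V.1 p) = (comp 0 V).1 p • unit 0
      + (comp 1 V).1 p • unit 1 + (comp 2 V).1 p • unit 2 := fun p => by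
    rw [vecField_apply V p]; simp only [map_add, map_smul, conjInv_mulL_cancel]
  have hW : ∀ p : H31, mulL (conjInv p) (W.1 p) = (comp 0 W).1 p • unit 0
      + (comp 1 W).1 p • unit 1 + (comp 2 W).1 p • unit 2 := fun p => by
    rw [vecField_apply W p]; simp only [map_add, map_smul, conjInv_mulL_cancel]
  simp only [hV, hW] at key'
  refine ⟨SmoothFun.ext' fun p => ?_, SmoothFun.ext' fun p => ?_, SmoothFun.ext' fun p => ?_⟩
  · refine (key' p 0).trans (Eq.trans ?_ (show _ = (der V (comp 0 W)).1 p - (der W (comp 0 V)).1 p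
      - 2 * ((comp 1 V).1 p * (comp 2 W).1 p - (comp 2 V).1 p * (comp 1 W).1 p) from rfl))
    simp [imCoord, unit, mulL_apply]
    ring
  · refine (key' p 1).trans (Eq.trans ?_ (show _ = (der V (comp 1 W)).1 p - (der W (comp 1 V)).1 p
      + 2 * ((comp 2 V).1 p * (comp 0 W).1 p - (comp 0 V).1 p * (comp 2 W).1 p) from rfl))
    simp [imCoord, unit, mulL_apply]
    ring
  · refine (key' p 2).trans (Eq.trans ?_ (show _ = (der V (comp 2 W)).1 p - (der W (comp 2 V)).1 p
      + 2 * ((comp 0 V).1 p * (comp 1 W).1 p - (comp 1 V).1 p * (comp 0 W).1 p) from rfl))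
    simp [imCoord, unit, mulL_apply]
    ring

/-! ### The Levi-Civita connection and the homogeneous structure in the frame -/

/-- Components of `∇_X Y` for the connection whose coefficients in the left-invariant frame are
those of the Levi-Civita connection of `-ν θ⁰⊗θ⁰ + μ θ¹⊗θ¹ + ν θ²⊗θ²`, with `α = μ/ν`. -/
def lcField (α : ℝ) (X Y : VecField) : VecField :=
  let c := algebraMap ℝ SmoothFun α
  ofComp ![der X (comp 0 Y) - (2 - c) * (comp 1 X * comp 2 Y) + c * (comp 2 X * comp 1 Y),
    der X (comp 1 Y) - comp 0 X * comp 2 Y + comp 2 X * comp 0 Y,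
    der X (comp 2 Y) + c * (comp 0 X * comp 1 Y) - (2 - c) * (comp 1 X * comp 0 Y)]

lemma comp_lcField (α : ℝ) (X Y : VecField) :
    comp 0 (lcField α X Y) = der X (comp 0 Y)
      - (2 - algebraMap ℝ SmoothFun α) * (comp 1 X * comp 2 Y)
      + algebraMap ℝ SmoothFun α * (comp 2 X * comp 1 Y) ∧
    comp 1 (lcField α X Y) = der X (comp 1 Y) - comp 0 X * comp 2 Y + comp 2 X * comp 0 Y ∧
    comp 2 (lcField α X Y) = der X (comp 2 Y)
      + algebraMap ℝ SmoothFun α * (comp 0 X * comp 1 Y)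
      - (2 - algebraMap ℝ SmoothFun α) * (comp 1 X * comp 0 Y) :=
  ⟨comp_ofComp 0 _, comp_ofComp 1 _, comp_ofComp 2 _⟩

lemma VecField.ext_comp3 {V W : VecField} (h0 : comp 0 V = comp 0 W) (h1 : comp 1 V = comp 1 W)
    (h2 : comp 2 V = comp 2 W) : V = W :=
  VecField.ext_comp fun a => by fin_cases a <;> assumption

lemma lcField_add_left (α : ℝ) (X X' Y : VecField) :
    lcField α (X + X') Y = lcField α X Y + lcField α X' Y := by
  obtain ⟨a0, a1, a2⟩ := comp_lcField α (X + X') Y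
  obtain ⟨b0, b1, b2⟩ := comp_lcField α X Y
  obtain ⟨c0, c1, c2⟩ := comp_lcField α X' Y
  refine VecField.ext_comp3 ?_ ?_ ?_
  · rw [comp_add, a0, b0, c0, der_add_left, comp_add, comp_add]; ring
  · rw [comp_add, a1, b1, c1, der_add_left, comp_add, comp_add]; ring
  · rw [comp_add, a2, b2, c2, der_add_left, comp_add, comp_add]; ring

lemma lcField_smul_left (α : ℝ) (f : SmoothFun) (X Y : VecField) :
    lcField α (f • X) Y = f • lcField α X Y := by
  obtain ⟨a0, a1, a2⟩ := comp_lcField α (f • X) Y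
  obtain ⟨b0, b1, b2⟩ := comp_lcField α X Y
  refine VecField.ext_comp3 ?_ ?_ ?_
  · rw [comp_smul, a0, b0, der_smul_left, comp_smul, comp_smul]; ring
  · rw [comp_smul, a1, b1, der_smul_left, comp_smul, comp_smul]; ring
  · rw [comp_smul, a2, b2, der_smul_left, comp_smul, comp_smul]; ring

lemma lcField_add_right (α : ℝ) (X Y Y' : VecField) :
    lcField α X (Y + Y') = lcField α X Y + lcField α X Y' := by
  obtain ⟨a0, a1, a2⟩ := comp_lcField α X (Y + Y')
  obtain ⟨b0, b1, b2⟩ := comp_lcField α X Y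
  obtain ⟨c0, c1, c2⟩ := comp_lcField α X Y'
  refine VecField.ext_comp3 ?_ ?_ ?_
  · rw [comp_add, a0, b0, c0]; simp only [comp_add, der_add]; ring
  · rw [comp_add, a1, b1, c1]; simp only [comp_add, der_add]; ring
  · rw [comp_add, a2, b2, c2]; simp only [comp_add, der_add]; ring

lemma lcField_smul_right (α : ℝ) (X : VecField) (f : SmoothFun) (Y : VecField) :
    lcField α X (f • Y) = der X f • Y + f • lcField α X Y := by
  obtain ⟨a0, a1, a2⟩ := comp_lcField α X (f • Y)
  obtain ⟨b0, b1, b2⟩ := comp_lcField α X Y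
  refine VecField.ext_comp3 ?_ ?_ ?_
  · rw [comp_add, comp_smul, comp_smul, a0, b0]; simp only [comp_smul, der_mul]; ring
  · rw [comp_add, comp_smul, comp_smul, a1, b1]; simp only [comp_smul, der_mul]; ring
  · rw [comp_add, comp_smul, comp_smul, a2, b2]; simp only [comp_smul, der_mul]; ring

/-- The connection `lcField`. -/
def lcConn (α : ℝ) : AffineConnection where
  cov :=
    { toFun := lcField α
      map_add' := fun X X' => funext fun Y => lcField_add_left α X X' Y
      map_smul' := fun f X => funext fun Y => lcField_smul_left α f X Y }
  cov_add := lcField_add_right α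
  leibniz := fun X f Y p =>
    congrArg (fun V : VecField => V.1 p) (lcField_smul_right α X f Y)

/-- The tensor of type `(1,2)` of `Smu`, with `α = μ/ν` and `τ = t/ν`. -/
def strField (α τ : ℝ) (X Y : VecField) : VecField :=
  let c := algebraMap ℝ SmoothFun α
  let d := algebraMap ℝ SmoothFun τ
  ofComp ![c * (comp 2 X * comp 1 Y) - d * (comp 1 X * comp 2 Y),
    comp 2 X * comp 0 Y - comp 0 X * comp 2 Y,
    c * (comp 0 X * comp 1 Y) - d * (comp 1 X * comp 0 Y)]

lemma comp_strField (α τ : ℝ) (X Y : VecField) :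
    comp 0 (strField α τ X Y) = algebraMap ℝ SmoothFun α * (comp 2 X * comp 1 Y)
      - algebraMap ℝ SmoothFun τ * (comp 1 X * comp 2 Y) ∧
    comp 1 (strField α τ X Y) = comp 2 X * comp 0 Y - comp 0 X * comp 2 Y ∧
    comp 2 (strField α τ X Y) = algebraMap ℝ SmoothFun α * (comp 0 X * comp 1 Y)
      - algebraMap ℝ SmoothFun τ * (comp 1 X * comp 0 Y) :=
  ⟨comp_ofComp 0 _, comp_ofComp 1 _, comp_ofComp 2 _⟩

/-- The tensor `strField` as a bilinear map. -/
def strTensor (α τ : ℝ) : Tensor12 :=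
  LinearMap.mk₂ SmoothFun (strField α τ)
    (fun X X' Y => by
      obtain ⟨a0, a1, a2⟩ := comp_strField α τ (X + X') Y
      obtain ⟨b0, b1, b2⟩ := comp_strField α τ X Y
      obtain ⟨c0, c1, c2⟩ := comp_strField α τ X' Y
      refine VecField.ext_comp3 ?_ ?_ ?_
      · rw [comp_add, a0, b0, c0]; simp only [comp_add]; ring
      · rw [comp_add, a1, b1, c1]; simp only [comp_add]; ring
      · rw [comp_add, a2, b2, c2]; simp only [comp_add]; ring)
    (fun f X Y => by
      obtain ⟨a0, a1, a2⟩ := comp_strField α τ (f • X) Y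
      obtain ⟨b0, b1, b2⟩ := comp_strField α τ X Y
      refine VecField.ext_comp3 ?_ ?_ ?_
      · rw [comp_smul, a0, b0]; simp only [comp_smul]; ring
      · rw [comp_smul, a1, b1]; simp only [comp_smul]; ring
      · rw [comp_smul, a2, b2]; simp only [comp_smul]; ring)
    (fun X Y Y' => by
      obtain ⟨a0, a1, a2⟩ := comp_strField α τ X (Y + Y')
      obtain ⟨b0, b1, b2⟩ := comp_strField α τ X Y
      obtain ⟨c0, c1, c2⟩ := comp_strField α τ X Y'
      refine VecField.ext_comp3 ?_ ?_ ?_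
      · rw [comp_add, a0, b0, c0]; simp only [comp_add]; ring
      · rw [comp_add, a1, b1, c1]; simp only [comp_add]; ring
      · rw [comp_add, a2, b2, c2]; simp only [comp_add]; ring)
    (fun f X Y => by
      obtain ⟨a0, a1, a2⟩ := comp_strField α τ X (f • Y)
      obtain ⟨b0, b1, b2⟩ := comp_strField α τ X Y
      refine VecField.ext_comp3 ?_ ?_ ?_
      · rw [comp_smul, a0, b0]; simp only [comp_smul]; ring
      · rw [comp_smul, a1, b1]; simp only [comp_smul]; ring
      · rw [comp_smul, a2, b2]; simp only [comp_smul]; ring)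

/-- The canonical connection `∇ - S`. -/
abbrev canonD (α τ : ℝ) : VecField → VecField → VecField := canonical (lcConn α) (strTensor α τ)

/-- The terms in `comp 0 X` and `comp 2 X` are the same in `lcField` and `strField` and cancel. Only
the connection form `κ θ¹ ⊗ B` survives, with `κ = α + τ - 2`. -/
lemma comp_canonD (α τ : ℝ) (X Y : VecField) :
    comp 0 (canonD α τ X Y) = der X (comp 0 Y)
      + algebraMap ℝ SmoothFun (α + τ - 2) * (comp 1 X * comp 2 Y) ∧
    comp 1 (canonD α τ X Y) = der X (comp 1 Y) ∧
    comp 2 (canonD α τ X Y) = der X (comp 2 Y)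
      + algebraMap ℝ SmoothFun (α + τ - 2) * (comp 1 X * comp 0 Y) := by
  have h : canonD α τ X Y = lcField α X Y - strField α τ X Y := rfl
  obtain ⟨a0, a1, a2⟩ := comp_lcField α X Y
  obtain ⟨b0, b1, b2⟩ := comp_strField α τ X Y
  have e : algebraMap ℝ SmoothFun (α + τ - 2)
      = algebraMap ℝ SmoothFun α + algebraMap ℝ SmoothFun τ - 2 := by
    rw [map_sub, map_add, map_ofNat]
  rw [h, e]
  refine ⟨?_, ?_, ?_⟩
  · rw [comp_sub, a0, b0]; ring
  · rw [comp_sub, a1, b1]; ring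
  · rw [comp_sub, a2, b2]; ring

lemma lcField_torsion (α : ℝ) (X Y : VecField) :
    lcField α X Y - lcField α Y X = bracket X Y := by
  obtain ⟨a0, a1, a2⟩ := comp_lcField α X Y
  obtain ⟨b0, b1, b2⟩ := comp_lcField α Y X
  obtain ⟨c0, c1, c2⟩ := comp_bracket X Y
  refine VecField.ext_comp3 ?_ ?_ ?_
  · rw [comp_sub, a0, b0, c0]; ring
  · rw [comp_sub, a1, b1, c1]; ring
  · rw [comp_sub, a2, b2, c2]; ring

/-- The metric evaluated on two vector fields. -/
def metricFun (lam mu nu : ℝ) (Y Z : VecField) : SmoothFun :=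
  algebraMap ℝ SmoothFun lam * (comp 0 Y * comp 0 Z)
    + algebraMap ℝ SmoothFun mu * (comp 1 Y * comp 1 Z)
    + algebraMap ℝ SmoothFun nu * (comp 2 Y * comp 2 Z)

lemma metricParallel_of {lam mu nu : ℝ} {D : VecField → VecField → VecField}
    (h : ∀ X Y Z, der X (metricFun lam mu nu Y Z)
      = metricFun lam mu nu (D X Y) Z + metricFun lam mu nu Y (D X Z)) :
    MetricParallel (kkMetric lam mu nu) D := fun X Y Z p =>
  congrArg (fun f : SmoothFun => f.1 p) (h X Y Z)

lemma der_metricFun (lam mu nu : ℝ) (X Y Z : VecField) :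
    der X (metricFun lam mu nu Y Z) =
      algebraMap ℝ SmoothFun lam * (der X (comp 0 Y) * comp 0 Z + comp 0 Y * der X (comp 0 Z))
    + algebraMap ℝ SmoothFun mu * (der X (comp 1 Y) * comp 1 Z + comp 1 Y * der X (comp 1 Z))
    + algebraMap ℝ SmoothFun nu * (der X (comp 2 Y) * comp 2 Z + comp 2 Y * der X (comp 2 Z)) := by
  simp only [metricFun, der_add, der_mul, der_algebraMap]
  ring

lemma lcConn_isLeviCivita {lam mu nu : ℝ} (hnu : nu ≠ 0) (h1 : -lam = nu) :
    IsLeviCivita (kkMetric lam mu nu) (lcConn (mu / nu)) := by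
  refine ⟨metricParallel_of fun X Y Z => ?_, lcField_torsion _⟩
  have e1 : algebraMap ℝ SmoothFun lam = -algebraMap ℝ SmoothFun nu := by
    rw [← h1, map_neg]; ring
  -- Division is cleared here, because the metric identity is then checked by `ring` in the
  -- commutative ring of smooth functions, which is not a field.
  have e2 : algebraMap ℝ SmoothFun nu * algebraMap ℝ SmoothFun (mu / nu)
      = algebraMap ℝ SmoothFun mu := by
    rw [← map_mul, mul_div_cancel₀ _ hnu]
  obtain ⟨a0, a1, a2⟩ := comp_lcField (mu / nu) X Y
  obtain ⟨b0, b1, b2⟩ := comp_lcField (mu / nu) X Z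
  change _ = metricFun lam mu nu (lcField (mu / nu) X Y) Z
    + metricFun lam mu nu Y (lcField (mu / nu) X Z)
  rw [der_metricFun, metricFun, metricFun, a0, a1, a2, b0, b1, b2, e1, ← e2]
  ring

lemma kkMetric_strField {lam mu nu t : ℝ} (hnu : nu ≠ 0) (h1 : -lam = nu) (X Y Z : VecField)
    (p : H31) :
    kkMetric lam mu nu p ((strTensor (mu / nu) (t / nu) X Y).1 p) (Z.1 p)
      = Smu mu t p (X.1 p) (Y.1 p) (Z.1 p) := by
  obtain ⟨b0, b1, b2⟩ := comp_strField (mu / nu) (t / nu) X Y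
  have c0 := congrArg (fun f : SmoothFun => f.1 p) b0
  have c1 := congrArg (fun f : SmoothFun => f.1 p) b1
  have c2 := congrArg (fun f : SmoothFun => f.1 p) b2
  change θ 0 p ((strTensor (mu / nu) (t / nu) X Y).1 p)
    = mu / nu * (θ 2 p (X.1 p) * θ 1 p (Y.1 p)) - t / nu * (θ 1 p (X.1 p) * θ 2 p (Y.1 p)) at c0
  change θ 1 p ((strTensor (mu / nu) (t / nu) X Y).1 p)
    = θ 2 p (X.1 p) * θ 0 p (Y.1 p) - θ 0 p (X.1 p) * θ 2 p (Y.1 p) at c1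
  change θ 2 p ((strTensor (mu / nu) (t / nu) X Y).1 p)
    = mu / nu * (θ 0 p (X.1 p) * θ 1 p (Y.1 p)) - t / nu * (θ 1 p (X.1 p) * θ 0 p (Y.1 p)) at c2
  obtain rfl : lam = -nu := by linarith
  rw [kkMetric, c0, c1, c2, Smu, wedge, wedge, wedge]
  field_simp
  ring

/-! ### Parallelism of the metric, of `S` and of the curvature. -/

lemma canonD_metricParallel {lam mu nu : ℝ} (h1 : -lam = nu) (α τ : ℝ) :
    MetricParallel (kkMetric lam mu nu) (canonD α τ) := by
  refine metricParallel_of fun X Y Z => ?_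
  have e1 : algebraMap ℝ SmoothFun lam = -algebraMap ℝ SmoothFun nu := by
    rw [← h1, map_neg]; ring
  obtain ⟨a0, a1, a2⟩ := comp_canonD α τ X Y
  obtain ⟨b0, b1, b2⟩ := comp_canonD α τ X Z
  rw [der_metricFun, metricFun, metricFun, a0, a1, a2, b0, b1, b2, e1]
  ring

/-- The coefficients of `strField` in the frame are constant, so its covariant derivative is `κ θ¹`
times the action of `B` on it, and that action is zero. -/
lemma canonD_str_parallel (α τ : ℝ) (X Y Z : VecField) :
    canonD α τ X (strTensor α τ Y Z) - strTensor α τ (canonD α τ X Y) Z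
      - strTensor α τ Y (canonD α τ X Z) = 0 := by
  change canonD α τ X (strField α τ Y Z) - strField α τ (canonD α τ X Y) Z
      - strField α τ Y (canonD α τ X Z) = 0
  obtain ⟨a0, a1, a2⟩ := comp_canonD α τ X (strField α τ Y Z)
  obtain ⟨b0, b1, b2⟩ := comp_strField α τ (canonD α τ X Y) Z
  obtain ⟨c0, c1, c2⟩ := comp_strField α τ Y (canonD α τ X Z)
  obtain ⟨d0, d1, d2⟩ := comp_strField α τ Y Z
  obtain ⟨p0, p1, p2⟩ := comp_canonD α τ X Y
  obtain ⟨q0, q1, q2⟩ := comp_canonD α τ X Z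
  refine VecField.ext_comp3 ?_ ?_ ?_
  · rw [comp_sub, comp_sub, comp_zero, a0, b0, c0, d0, d2, p1, p2, q1, q2]
    simp only [der_sub, der_mul, der_algebraMap]; ring
  · rw [comp_sub, comp_sub, comp_zero, a1, b1, c1, d1, p0, p2, q0, q2]
    simp only [der_sub, der_mul]; ring
  · rw [comp_sub, comp_sub, comp_zero, a2, b2, c2, d0, d2, p1, p0, q1, q0]
    simp only [der_sub, der_mul, der_algebraMap]; ring

/-- Each two-form `θ^a ∧ θ^b` comes with an infinitesimal isometry of its own plane. The
coefficients are constant, which is what the parallelism of the curvature needs. -/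
lemma comp_curvature_lcConn (α : ℝ) (X Y Z : VecField) :
    comp 0 (curvature (fun X Y => (lcConn α).cov X Y) X Y Z) =
      (4 - 3 * algebraMap ℝ SmoothFun α) * (comp 2 X * comp 0 Y - comp 0 X * comp 2 Y) * comp 2 Z
      - algebraMap ℝ SmoothFun α ^ 2 * (comp 0 X * comp 1 Y - comp 1 X * comp 0 Y) * comp 1 Z ∧
    comp 1 (curvature (fun X Y => (lcConn α).cov X Y) X Y Z) =
      -(algebraMap ℝ SmoothFun α * (comp 1 X * comp 2 Y - comp 2 X * comp 1 Y) * comp 2 Z)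
      - algebraMap ℝ SmoothFun α * (comp 0 X * comp 1 Y - comp 1 X * comp 0 Y) * comp 0 Z ∧
    comp 2 (curvature (fun X Y => (lcConn α).cov X Y) X Y Z) =
      (4 - 3 * algebraMap ℝ SmoothFun α) * (comp 2 X * comp 0 Y - comp 0 X * comp 2 Y) * comp 0 Z
      + algebraMap ℝ SmoothFun α ^ 2 * (comp 1 X * comp 2 Y - comp 2 X * comp 1 Y) * comp 1 Z := by
  have hR : curvature (fun X Y => (lcConn α).cov X Y) X Y Z
    = lcField α X (lcField α Y Z) - lcField α Y (lcField α X Z)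
    - lcField α (bracket X Y) Z := rfl
  obtain ⟨a0, a1, a2⟩ := comp_lcField α X (lcField α Y Z)
  obtain ⟨b0, b1, b2⟩ := comp_lcField α Y (lcField α X Z)
  obtain ⟨c0, c1, c2⟩ := comp_lcField α (bracket X Y) Z
  obtain ⟨d0, d1, d2⟩ := comp_lcField α Y Z
  obtain ⟨e0, e1, e2⟩ := comp_lcField α X Z
  obtain ⟨f0, f1, f2⟩ := comp_bracket X Y
  rw [hR]
  refine ⟨?_, ?_, ?_⟩
  · rw [comp_sub, comp_sub, a0, b0, c0, d0, d1, d2, e0, e1, e2, f1, f2, der_bracket]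
    simp only [der_sub, der_add, der_mul, der_algebraMap, der_two]
    ring
  · rw [comp_sub, comp_sub, a1, b1, c1, d0, d1, d2, e0, e1, e2, f0, f2, der_bracket]
    simp only [der_sub, der_add, der_mul]
    ring
  · rw [comp_sub, comp_sub, a2, b2, c2, d0, d1, d2, e0, e1, e2, f1, f0, der_bracket]
    simp only [der_sub, der_add, der_mul, der_algebraMap, der_two]
    ring

/-- The connection form `κ θ¹ ⊗ B` takes values in one line, so it has no commutator term and the
curvature is `κ dθ¹ ⊗ B`. The factor `-2` comes from `[X2, X0] = 2 X1`. -/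
lemma comp_curvature_canonD (α τ : ℝ) (X Y Z : VecField) :
    comp 0 (curvature (canonD α τ) X Y Z) = -2 * algebraMap ℝ SmoothFun (α + τ - 2)
      * (comp 2 X * comp 0 Y - comp 0 X * comp 2 Y) * comp 2 Z ∧
    comp 1 (curvature (canonD α τ) X Y Z) = 0 ∧
    comp 2 (curvature (canonD α τ) X Y Z) = -2 * algebraMap ℝ SmoothFun (α + τ - 2)
      * (comp 2 X * comp 0 Y - comp 0 X * comp 2 Y) * comp 0 Z := by
  obtain ⟨a0, a1, a2⟩ := comp_canonD α τ X (canonD α τ Y Z)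
  obtain ⟨b0, b1, b2⟩ := comp_canonD α τ Y (canonD α τ X Z)
  obtain ⟨c0, c1, c2⟩ := comp_canonD α τ (bracket X Y) Z
  obtain ⟨d0, d1, d2⟩ := comp_canonD α τ Y Z
  obtain ⟨e0, e1, e2⟩ := comp_canonD α τ X Z
  obtain ⟨f0, f1, f2⟩ := comp_bracket X Y
  rw [curvature]
  refine ⟨?_, ?_, ?_⟩
  · rw [comp_sub, comp_sub, a0, b0, c0, d0, d2, e0, e2, f1, der_bracket]
    simp only [der_add, der_mul, der_algebraMap]
    ring
  · rw [comp_sub, comp_sub, a1, b1, c1, d1, e1, der_bracket]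
    ring
  · rw [comp_sub, comp_sub, a2, b2, c2, d0, d2, e0, e2, f1, der_bracket]
    simp only [der_add, der_mul, der_algebraMap]
    ring

/-- As for `S`: the Levi-Civita curvature has constant coefficients and is invariant under `B`. -/
lemma canonD_curvature_parallel (α τ : ℝ) (X Y Z W : VecField) :
    canonD α τ X (curvature (fun X Y => (lcConn α).cov X Y) Y Z W)
      - curvature (fun X Y => (lcConn α).cov X Y) (canonD α τ X Y) Z W
      - curvature (fun X Y => (lcConn α).cov X Y) Y (canonD α τ X Z) W
      - curvature (fun X Y => (lcConn α).cov X Y) Y Z (canonD α τ X W) = 0 := by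
  obtain ⟨a0, a1, a2⟩ := comp_canonD α τ X (curvature (fun X Y => (lcConn α).cov X Y) Y Z W)
  obtain ⟨b0, b1, b2⟩ := comp_curvature_lcConn α Y Z W
  obtain ⟨c0, c1, c2⟩ := comp_curvature_lcConn α (canonD α τ X Y) Z W
  obtain ⟨d0, d1, d2⟩ := comp_curvature_lcConn α Y (canonD α τ X Z) W
  obtain ⟨e0, e1, e2⟩ := comp_curvature_lcConn α Y Z (canonD α τ X W)
  obtain ⟨p0, p1, p2⟩ := comp_canonD α τ X Y
  obtain ⟨q0, q1, q2⟩ := comp_canonD α τ X Z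
  obtain ⟨r0, r1, r2⟩ := comp_canonD α τ X W
  refine VecField.ext_comp3 ?_ ?_ ?_
  · rw [comp_sub, comp_sub, comp_sub, comp_zero, a0, b0, b2, c0, d0, e0, p0, p1, p2, q0, q1, q2,
      r1, r2]
    simp only [der_sub, der_mul, der_three, der_four, pow_two, der_algebraMap]; ring
  · rw [comp_sub, comp_sub, comp_sub, comp_zero, a1, b1, c1, d1, e1, p0, p1, p2, q0, q1, q2,
      r0, r2]
    simp only [der_sub, der_neg, der_mul, der_algebraMap]; ring
  · rw [comp_sub, comp_sub, comp_sub, comp_zero, a2, b0, b2, c2, d2, e2, p0, p1, p2, q0, q1, q2,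
      r0, r1]
    simp only [der_sub, der_add, der_mul, der_three, der_four, pow_two, der_algebraMap]; ring

lemma canonD_isHomogeneousStructure {lam mu nu : ℝ} (h1 : -lam = nu) (α τ : ℝ) :
    IsHomogeneousStructure (kkMetric lam mu nu) (lcConn α) (strTensor α τ) :=
  ⟨canonD_metricParallel h1 α τ, canonD_curvature_parallel α τ, canonD_str_parallel α τ⟩

/-! ### The actions in coordinates -/

/-- The first row of a matrix. -/
def row (M : Matrix (Fin 2) (Fin 2) ℂ) : ℂ × ℂ := (M 0 0, M 0 1)

lemma row_toMat (z : ℂ × ℂ) : row (toMat z) = z := by simp [row, toMat]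

lemma toMat_coordL (A : SU11) : toMat (coordL A) = A.1.1 := SU11_form A

lemma coordL_mem (A : SU11) : coordL A ∈ H31 := (toSU.symm A).2

lemma coordL_mul (A B : SU11) : coordL (A * B) = mulL (coordL A) (coordL B) := by
  rw [← row_toMat (mulL _ _), toMat_mulL, toMat_coordL, toMat_coordL]; rfl

lemma coordL_toSU (p : H31) : coordL (toSU p) = p := by
  rw [coordL, Equiv.symm_apply_apply]

lemma coordL_injective : Function.Injective coordL := fun _ _ h =>
  toSU.symm.injective (Subtype.ext h)

/-- The point of the hypersurface corresponding to `boost s`. -/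
def boostRow (s : ℝ) : ℂ × ℂ := ((Real.cosh s : ℂ), (-Real.sinh s : ℂ))

lemma coordL_boost (s : ℝ) : coordL (boost s) = boostRow s := by
  rw [← row_toMat (coordL _), toMat_coordL, boost_coe]; rfl

lemma boostRow_zero : boostRow 0 = (1, 0) := by simp [boostRow]

lemma coe_smul (γ : SU11R) (p : H31) :
    ((γ • p : H31) : ℂ × ℂ) = mulL (mulL (coordL γ.1) p) (boostRow γ.2.toAdd) := by
  change coordL (γ.1 * toSU p * boost γ.2.toAdd) = _
  rw [coordL_mul, coordL_mul, coordL_toSU, coordL_boost]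

lemma coe_smul_left (A : SU11) (p : H31) : ((A • p : H31) : ℂ × ℂ) = mulL (coordL A) p := by
  change coordL (A * toSU p) = _
  rw [coordL_mul, coordL_toSU]

/-- The left action is the restriction of the larger one to `s = 0`, so its properties can be read
off from those of `SU11R`. -/
lemma left_smul_eq (A : SU11) (p : H31) : A • p = ((A, 1) : SU11R) • p := by
  apply Subtype.ext
  rw [coe_smul, coe_smul_left]
  change _ = mulL _ (boostRow 0)
  rw [boostRow_zero, mulL_one]

/-- The linear extension of the transformation defined by a group element. -/
def actL (γ : SU11R) : (ℂ × ℂ) →L[ℝ] (ℂ × ℂ) :=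
  (mulL.flip (boostRow γ.2.toAdd)).comp (mulL (coordL γ.1))

lemma actL_apply (γ : SU11R) (v : ℂ × ℂ) :
    actL γ v = mulL (mulL (coordL γ.1) v) (boostRow γ.2.toAdd) := rfl

lemma act_eq (γ : SU11R) (p : H31) : act γ p = actL γ p := coe_smul γ p

lemma diff_act (γ : SU11R) (p : H31) {v : ℂ × ℂ} (hv : v ∈ tangent p) :
    diff (act γ) p v = actL γ v := diff_linear _ (act_eq γ) p hv

lemma conjInv_mul (z w : ℂ × ℂ) : conjInv (mulL z w) = mulL (conjInv w) (conjInv z) := by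
  ext1 <;> simp [mulL_apply, conjInv] <;> ring

/-- In `(A p b)⁻¹ (A v b)` the factor `A` cancels, and conjugation of `p⁻¹ v` by the boost remains.
-/
lemma conjInv_mulL_act (γ : SU11R) (p : H31) (v : ℂ × ℂ) :
    mulL (conjInv (γ • p : H31)) (actL γ v) = mulL (mulL (conjInv (boostRow γ.2.toAdd))
      (mulL (conjInv p) v)) (boostRow γ.2.toAdd) := by
  have h := conjInv_mulL_cancel ⟨coordL γ.1, coordL_mem γ.1⟩ v
  rw [coe_smul, actL_apply, conjInv_mul, conjInv_mul]
  simp only [← mulL_assoc] at *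
  rw [mulL_assoc (mulL (mulL _ _) _) (coordL γ.1) v]
  rw [mulL_assoc (mulL (conjInv _) _) (conjInv _) (mulL _ _), ← mulL_assoc (conjInv _) _ v, h]

/-- The argument doubles because `ad X1` has eigenvalues `±2` on the plane of `X0` and `X2`. -/
lemma boost_conj (s : ℝ) (w : ℂ × ℂ) :
    mulL (mulL (conjInv (boostRow s)) w) (boostRow s) =
      (⟨w.1.re, Real.cosh (2 * s) * w.1.im - Real.sinh (2 * s) * w.2.im⟩,
        ⟨w.2.re, Real.cosh (2 * s) * w.2.im - Real.sinh (2 * s) * w.1.im⟩) := by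
  have h := Real.cosh_sq s
  rw [Real.cosh_two_mul, Real.sinh_two_mul]
  ext1 <;> apply Complex.ext <;>
    simp [mulL_apply, conjInv, boostRow, -Complex.ofReal_cosh, -Complex.ofReal_sinh]
  · linear_combination w.1.re * h
  · ring
  · linear_combination w.2.re * h
  · ring

lemma θ_act (γ : SU11R) (p : H31) (v : ℂ × ℂ) :
    θ 0 (γ • p) (actL γ v) = Real.cosh (2 * γ.2.toAdd) * θ 0 p v
      - Real.sinh (2 * γ.2.toAdd) * θ 2 p v ∧
    θ 1 (γ • p) (actL γ v) = θ 1 p v ∧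
    θ 2 (γ • p) (actL γ v) = Real.cosh (2 * γ.2.toAdd) * θ 2 p v
      - Real.sinh (2 * γ.2.toAdd) * θ 0 p v := by
  simp only [θ_eq, conjInv_mulL_act, boost_conj]
  exact ⟨rfl, rfl, rfl⟩

lemma actL_mem_tangent (γ : SU11R) {p : H31} {v : ℂ × ℂ} (hv : v ∈ tangent p) :
    actL γ v ∈ tangent (γ • p) := by
  change ambientForm _ _ = 0
  rw [← re_conjInv_mulL, conjInv_mulL_act, boost_conj]
  exact re_of_mem_tangent hv

lemma actsByIsometry {lam mu nu : ℝ} (h1 : -lam = nu) (γ : SU11R) :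
    ActsByIsometry (kkMetric lam mu nu) γ := by
  refine ⟨isSmooth_linear _ (act_eq γ), fun p v hv w hw => ?_⟩
  obtain ⟨a0, a1, a2⟩ := θ_act γ p v
  obtain ⟨b0, b1, b2⟩ := θ_act γ p w
  have h := Real.cosh_sq (2 * γ.2.toAdd)
  rw [diff_act γ p hv, diff_act γ p hw, kkMetric, kkMetric, a0, a1, a2, b0, b1, b2]
  subst h1
  linear_combination (lam * θ 0 p v * θ 0 p w - lam * θ 2 p v * θ 2 p w) * h

lemma act_left_eq (A : SU11) : act A = act ((A, 1) : SU11R) :=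
  funext fun p => congrArg Subtype.val (left_smul_eq A p)

lemma actsByIsometry_left {lam mu nu : ℝ} (h1 : -lam = nu) (A : SU11) :
    ActsByIsometry (kkMetric lam mu nu) A := by
  have h := actsByIsometry (mu := mu) h1 ((A, 1) : SU11R)
  unfold ActsByIsometry at *
  simpa only [← act_left_eq, ← left_smul_eq] using h

lemma isPretransitive_left : MulAction.IsPretransitive SU11 H31 :=
  ⟨fun p q => ⟨toSU q * (toSU p)⁻¹, by
    change toSU.symm (toSU q * (toSU p)⁻¹ * toSU p) = q
    simp⟩⟩

lemma isPretransitive : MulAction.IsPretransitive SU11R H31 :=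
  ⟨fun p q => by
    obtain ⟨A, hA⟩ := isPretransitive_left.exists_smul_eq p q
    exact ⟨(A, 1), by rw [← left_smul_eq, hA]⟩⟩

lemma toSU_base : toSU base = 1 := by
  apply Subtype.ext; apply Subtype.ext
  change toMat (1, 0) = 1
  ext i j; fin_cases i <;> fin_cases j <;> simp [toMat]

lemma smul_base (γ : SU11R) : toSU (γ • base) = γ.1 * boost γ.2.toAdd := by
  change toSU (toSU.symm (γ.1 * toSU base * boost γ.2.toAdd)) = _
  rw [Equiv.apply_symm_apply, toSU_base, mul_one]

lemma boost_neg (s : ℝ) : boost (-s) = (boost s)⁻¹ := by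
  rw [eq_inv_iff_mul_eq_one, ← boost_add, add_neg_cancel, boost_zero]

/-- The base point is the identity matrix, so the condition is `A * boost s = 1`. -/
lemma mem_stabilizer_iff (γ : SU11R) :
    γ ∈ MulAction.stabilizer SU11R base ↔ γ.1 = boost (-γ.2.toAdd) := by
  rw [MulAction.mem_stabilizer_iff, ← toSU.injective.eq_iff, smul_base, toSU_base, boost_neg,
    mul_eq_one_iff_eq_inv]

lemma mem_stabilizer_left_iff (A : SU11) : A ∈ MulAction.stabilizer SU11 base ↔ A = 1 := by
  rw [MulAction.mem_stabilizer_iff, left_smul_eq, ← MulAction.mem_stabilizer_iff,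
    mem_stabilizer_iff]
  change A = boost (-0) ↔ _
  rw [neg_zero, boost_zero]

lemma faithfulSMul : FaithfulSMul SU11R H31 := by
  refine ⟨fun {γ δ} h => ?_⟩
  have hs : ∀ p : H31, (δ⁻¹ * γ) • p = p := fun p => by rw [mul_smul, h, inv_smul_smul]
  suffices δ⁻¹ * γ = 1 from (inv_mul_eq_one.1 this).symm
  generalize δ⁻¹ * γ = ε at hs
  obtain ⟨A, s⟩ := ε
  have h1 := (mem_stabilizer_iff (A, s)).1 (hs base)
  change A = boost (-s.toAdd) at h1
  -- Fixing `o` leaves a conjugation by a boost. Its action on the point `(i, 0)` produces `-2 cosh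
  -- s sinh s` as the imaginary part of the second entry, which forces `s = 0`.
  have h2 := congrArg Subtype.val (hs ⟨(Complex.I, 0), by simp [H31]⟩)
  rw [coe_smul] at h2
  change mulL (mulL (coordL A) _) (boostRow s.toAdd) = _ at h2
  rw [h1, coordL_boost] at h2
  have h3 := congrArg (fun z : ℂ × ℂ => z.2.im) h2
  simp [mulL_apply, boostRow, -Complex.ofReal_cosh, -Complex.ofReal_sinh] at h3
  have hc := Real.cosh_pos s.toAdd
  have h4 : Real.sinh s.toAdd = 0 := by
    have : Real.cosh s.toAdd * Real.sinh s.toAdd = 0 := by linarith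
    exact (mul_eq_zero.1 this).resolve_left hc.ne'
  have h5 : s.toAdd = 0 := Real.sinh_eq_zero.1 h4
  rw [h5, neg_zero, boost_zero] at h1
  exact Prod.ext h1 h5

lemma faithfulSMul_left : FaithfulSMul SU11 H31 :=
  ⟨fun {A B} h => by
    have := faithfulSMul.eq_of_smul_eq_smul (m₁ := ((A, 1) : SU11R)) (m₂ := (B, 1))
      fun p => by rw [← left_smul_eq, ← left_smul_eq, h]
    exact congrArg Prod.fst this⟩

lemma smoothAction_coordR : SmoothAction coordR := by
  -- `Function.extend` has the intended values on the range only because the embedding is injective.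
  -- There the action agrees with a map that is smooth on the whole ambient space.
  have hinj : Function.Injective
      (fun q : SU11R × H31 => (coordR q.1, (q.2 : ℂ × ℂ))) := fun q r h => by
    have h1 := congrArg (fun x => x.1.1) h
    have h2 := congrArg (fun x => x.1.2) h
    have h3 := congrArg (fun x => x.2) h
    exact Prod.ext (Prod.ext (coordL_injective h1) h2) (Subtype.ext h3)
  have hb : ContDiff ℝ ∞ boostRow :=
    (Complex.ofRealCLM.contDiff.comp Real.contDiff_cosh).prodMk
      (Complex.ofRealCLM.contDiff.comp Real.contDiff_sinh).neg
  have h : ContDiff ℝ ∞ (fun x : ((ℂ × ℂ) × ℝ) × (ℂ × ℂ) =>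
      mulL (mulL x.1.1 x.2) (boostRow x.1.2)) := by
    have h1 := hb.comp (contDiff_snd.comp contDiff_fst :
      ContDiff ℝ ∞ fun x : ((ℂ × ℂ) × ℝ) × (ℂ × ℂ) => x.1.2)
    exact (mulL.contDiff.comp ((mulL.contDiff.comp (contDiff_fst.comp contDiff_fst)).clm_apply
      contDiff_snd)).clm_apply h1
  refine h.contDiffOn.congr ?_
  rintro _ ⟨q, rfl⟩
  rw [hinj.extend_apply, coe_smul]
  rfl

lemma smoothAction_coordL : SmoothAction coordL := by
  have hinj : Function.Injective
      (fun q : SU11 × H31 => (coordL q.1, (q.2 : ℂ × ℂ))) := fun q r h =>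
    Prod.ext (coordL_injective (congrArg Prod.fst h)) (Subtype.ext (congrArg Prod.snd h))
  have h : ContDiff ℝ ∞ (fun x : (ℂ × ℂ) × (ℂ × ℂ) => mulL x.1 x.2) :=
    (mulL.contDiff.comp contDiff_fst).clm_apply contDiff_snd
  refine h.contDiffOn.congr ?_
  rintro _ ⟨q, rfl⟩
  rw [hinj.extend_apply, coe_smul_left]

/-! ### Invariance of the canonical connection. -/

lemma pushesTo_iff (γ : SU11R) (V V' : VecField) :
    PushesTo γ V V' ↔ ∀ p : H31,
      (comp 0 V').1 (γ • p) = Real.cosh (2 * γ.2.toAdd) * (comp 0 V).1 p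
        - Real.sinh (2 * γ.2.toAdd) * (comp 2 V).1 p ∧
      (comp 1 V').1 (γ • p) = (comp 1 V).1 p ∧
      (comp 2 V').1 (γ • p) = Real.cosh (2 * γ.2.toAdd) * (comp 2 V).1 p
        - Real.sinh (2 * γ.2.toAdd) * (comp 0 V).1 p := by
  refine forall_congr' fun p => ?_
  obtain ⟨a0, a1, a2⟩ := θ_act γ p (V.1 p)
  rw [diff_act γ p (V.2.2 p)]
  simp only [comp_apply, ← a0, ← a1, ← a2]
  refine ⟨fun h => by rw [h]; exact ⟨rfl, rfl, rfl⟩, fun ⟨h0, h1, h2⟩ =>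
    tangent_ext (V'.2.2 _) (actL_mem_tangent γ (V.2.2 p)) fun a => ?_⟩
  fin_cases a <;> assumption

lemma der_pushesTo {γ : SU11R} {V V' : VecField} (h : PushesTo γ V V') {f f' : SmoothFun}
    (hf : ∀ q, f'.1 (γ • q) = f.1 q) (p : H31) : (der V' f').1 (γ • p) = (der V f).1 p := by
  have e : (fun q => f'.1 (γ • q)) = f.1 := funext hf
  have h1 := diff_comp_linear f'.2 (actL γ) (fun q => γ • q) (coe_smul γ) (by rw [e]; exact f.2) p
    (V.2.2 p) (actL_mem_tangent γ (V.2.2 p))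
  have h2 := h p
  rw [diff_act γ p (V.2.2 p)] at h2
  rw [e] at h1
  change diff f'.1 (γ • p) (V'.1 (γ • p)) = diff f.1 p (V.1 p)
  rw [h2, h1]

/-- The group changes components by a constant matrix that fixes `θ¹` and commutes with `B`, hence
it preserves both the derivative term and `κ θ¹ ⊗ B`. -/
lemma canonD_pushesTo (α τ : ℝ) (γ : SU11R) (V V' W W' : VecField) (hV : PushesTo γ V V')
    (hW : PushesTo γ W W') : PushesTo γ (canonD α τ V W) (canonD α τ V' W') := by
  have hV' := (pushesTo_iff γ V V').1 hV
  have hW' := (pushesTo_iff γ W W').1 hW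
  rw [pushesTo_iff]
  intro p
  obtain ⟨-, v1, -⟩ := hV' p
  obtain ⟨w0, -, w2⟩ := hW' p
  obtain ⟨a0, a1, a2⟩ := comp_canonD α τ V W
  obtain ⟨b0, b1, b2⟩ := comp_canonD α τ V' W'
  set C := Real.cosh (2 * γ.2.toAdd)
  set S := Real.sinh (2 * γ.2.toAdd)
  have d0 := der_pushesTo hV (f' := comp 0 W') (f := algebraMap ℝ SmoothFun C * comp 0 W
    - algebraMap ℝ SmoothFun S * comp 2 W) (fun q => (hW' q).1) p
  have d1 := der_pushesTo hV (f' := comp 1 W') (f := comp 1 W) (fun q => (hW' q).2.1) p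
  have d2 := der_pushesTo hV (f' := comp 2 W') (f := algebraMap ℝ SmoothFun C * comp 2 W
    - algebraMap ℝ SmoothFun S * comp 0 W) (fun q => (hW' q).2.2) p
  simp only [der_sub, der_mul, der_algebraMap] at d0 d2
  -- The zero factors are the derivatives of the constants `C` and `S`.
  replace d0 : (der V' (comp 0 W')).1 (γ • p) = (0 * (comp 0 W).1 p + C * (der V (comp 0 W)).1 p)
    - (0 * (comp 2 W).1 p + S * (der V (comp 2 W)).1 p) := d0
  replace d2 : (der V' (comp 2 W')).1 (γ • p) = (0 * (comp 2 W).1 p + C * (der V (comp 2 W)).1 p)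
    - (0 * (comp 0 W).1 p + S * (der V (comp 0 W)).1 p) := d2
  rw [a0, a1, a2, b0, b1, b2]
  refine ⟨?_, d1, ?_⟩
  · change (der V' (comp 0 W')).1 (γ • p) + (α + τ - 2) * ((comp 1 V').1 (γ • p)
      * (comp 2 W').1 (γ • p)) = C * ((der V (comp 0 W)).1 p
      + (α + τ - 2) * ((comp 1 V).1 p * (comp 2 W).1 p)) - S * ((der V (comp 2 W)).1 p
      + (α + τ - 2) * ((comp 1 V).1 p * (comp 0 W).1 p))
    rw [d0, v1, w2]; ring
  · change (der V' (comp 2 W')).1 (γ • p) + (α + τ - 2) * ((comp 1 V').1 (γ • p)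
      * (comp 0 W').1 (γ • p)) = C * ((der V (comp 2 W)).1 p
      + (α + τ - 2) * ((comp 1 V).1 p * (comp 0 W).1 p)) - S * ((der V (comp 0 W)).1 p
      + (α + τ - 2) * ((comp 1 V).1 p * (comp 2 W).1 p))
    rw [d2, v1, w0]; ring

lemma canonD_pushesTo_left (α τ : ℝ) (A : SU11) (V V' W W' : VecField) (hV : PushesTo A V V')
    (hW : PushesTo A W W') : PushesTo A (canonD α τ V W) (canonD α τ V' W') := by
  have h := canonD_pushesTo α τ (A, 1) V V' W W'
  unfold PushesTo at *
  simp only [← act_left_eq, ← left_smul_eq] at h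
  exact h hV hW

/-! ### The Lie algebra and the exponential map -/

lemma su11_entries (X : su11) : X.1 1 1 = starRingEnd ℂ (X.1 0 0) ∧
    X.1 1 0 = starRingEnd ℂ (X.1 0 1) ∧ (X.1 0 0).re = 0 := by
  obtain ⟨X, htr, hJ⟩ := X
  rw [Matrix.trace_fin_two] at htr
  have h00 := congrFun (congrFun hJ 0) 0
  have h10 := congrFun (congrFun hJ 1) 0
  simp [sig, Matrix.mul_apply, Matrix.vecMul, dotProduct, Fin.sum_univ_two] at h00 h10
  refine ⟨?_, ?_, ?_⟩
  · linear_combination htr - h00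
  · linear_combination -h10
  · have := congrArg Complex.re h00
    simp at this
    simpa using this

lemma toMat_row (X : su11) : toMat (row X.1) = X.1 := by
  obtain ⟨h11, h10, -⟩ := su11_entries X
  ext i j
  fin_cases i <;> fin_cases j <;> simp [toMat, row, h11, h10]

lemma row_re (X : su11) : (row X.1).1.re = 0 := (su11_entries X).2.2

lemma su11_ext {X Y : su11} (h : row X.1 = row Y.1) : X = Y := by
  apply Subtype.ext; rw [← toMat_row X, h, toMat_row]

lemma row_lie (X Y : su11) :
    row (⁅X, Y⁆ : su11).1 = mulL (row X.1) (row Y.1) - mulL (row Y.1) (row X.1) := by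
  have h : (⁅X, Y⁆ : su11).1 = X.1 * Y.1 - Y.1 * X.1 := rfl
  have h1 : ∀ A B : Matrix (Fin 2) (Fin 2) ℂ, row (A - B) = row A - row B := fun A B => rfl
  rw [h, h1, ← row_toMat (mulL _ _), ← row_toMat (mulL (row Y.1) _), toMat_mulL, toMat_mulL,
    toMat_row, toMat_row]

/-- The coordinates on `su(1,1)` for the basis `X0, X1, X2`. -/
def suCoord (a : Fin 3) : su11 →ₗ[ℝ] ℝ where
  toFun X := imCoord a (row X.1)
  map_add' X Y := by fin_cases a <;> simp [imCoord, row]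
  map_smul' c X := by fin_cases a <;> simp [imCoord, row]

lemma suCoord_apply (a : Fin 3) (X : su11) : suCoord a X = imCoord a (row X.1) := rfl

lemma row_eq (X : su11) : row X.1 =
    (⟨0, suCoord 0 X⟩, ⟨suCoord 1 X, suCoord 2 X⟩) := by
  ext1
  · exact Complex.ext (row_re X) rfl
  · rfl

lemma su11_ext_coord {X Y : su11} (h0 : suCoord 0 X = suCoord 0 Y)
    (h1 : suCoord 1 X = suCoord 1 Y) (h2 : suCoord 2 X = suCoord 2 Y) : X = Y :=
  su11_ext (by rw [row_eq, row_eq, h0, h1, h2])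

lemma suCoord_X0 : suCoord 0 X0 = 1 ∧ suCoord 1 X0 = 0 ∧ suCoord 2 X0 = 0 := by
  simp [suCoord_apply, imCoord, row, X0]

lemma suCoord_X1 : suCoord 0 X1 = 0 ∧ suCoord 1 X1 = 1 ∧ suCoord 2 X1 = 0 := by
  simp [suCoord_apply, imCoord, row, X1]

lemma suCoord_X2 : suCoord 0 X2 = 0 ∧ suCoord 1 X2 = 0 ∧ suCoord 2 X2 = 1 := by
  simp [suCoord_apply, imCoord, row, X2]

lemma suCoord_lie (X Y : su11) :
    suCoord 0 ⁅X, Y⁆ = -2 * (suCoord 1 X * suCoord 2 Y - suCoord 2 X * suCoord 1 Y) ∧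
    suCoord 1 ⁅X, Y⁆ = 2 * (suCoord 2 X * suCoord 0 Y - suCoord 0 X * suCoord 2 Y) ∧
    suCoord 2 ⁅X, Y⁆ = 2 * (suCoord 0 X * suCoord 1 Y - suCoord 1 X * suCoord 0 Y) := by
  simp only [suCoord_apply _ ⁅X, Y⁆, row_lie, row_eq X, row_eq Y]
  simp [imCoord, mulL_apply]
  refine ⟨?_, ?_, ?_⟩ <;> ring

lemma hasDerivAt_coordL_expL (X : su11) :
    HasDerivAt (fun s : ℝ => coordL (expL (s • X))) (row X.1) 0 := by
  -- A submultiplicative norm is fixed locally so that the exponential can be differentiated in a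
  -- Banach algebra.
  let _ : NormedRing (Matrix (Fin 2) (Fin 2) ℂ) := Matrix.linftyOpNormedRing
  let _ : NormedAlgebra ℝ (Matrix (Fin 2) (Fin 2) ℂ) := Matrix.linftyOpNormedAlgebra
  have h := hasDerivAt_exp_smul_const (𝕂 := ℝ) X.1 (0 : ℝ)
  rw [zero_smul, NormedSpace.exp_zero, one_mul] at h
  let r : Matrix (Fin 2) (Fin 2) ℂ →L[ℝ] ℂ × ℂ := LinearMap.toContinuousLinearMap
    { toFun := row, map_add' := fun _ _ => rfl, map_smul' := fun _ _ => rfl }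
  exact r.hasFDerivAt.comp_hasDerivAt (0 : ℝ) h

lemma expL_smul_X1 (s : ℝ) : expL (s • X1) = boost (-s) := by
  apply Subtype.ext; apply Subtype.ext
  -- The columns of `P` are eigenvectors of `X1` for the eigenvalues `1` and `-1`.
  let P : Matrix (Fin 2) (Fin 2) ℂ := !![1, 1; 1, -1]
  let Q : Matrix (Fin 2) (Fin 2) ℂ := !![1 / 2, 1 / 2; 1 / 2, -1 / 2]
  have hPQ : P * Q = 1 := by
    ext i j; fin_cases i <;> fin_cases j <;>
      simp [P, Q, Matrix.mul_apply, Fin.sum_univ_two] <;> norm_num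
  have hQP : Q * P = 1 := by
    ext i j; fin_cases i <;> fin_cases j <;>
      simp [P, Q, Matrix.mul_apply, Fin.sum_univ_two] <;> norm_num
  let u : (Matrix (Fin 2) (Fin 2) ℂ)ˣ := ⟨P, Q, hPQ, hQP⟩
  have h1 := Matrix.exp_units_conj u (Matrix.diagonal ![(s : ℂ), -(s : ℂ)])
  have h2 : (s • X1).1 = (u : Matrix (Fin 2) (Fin 2) ℂ) * Matrix.diagonal ![(s : ℂ), -(s : ℂ)]
      * (u⁻¹ : (Matrix (Fin 2) (Fin 2) ℂ)ˣ) := by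
    change s • X1.1 = P * _ * Q
    ext i j; fin_cases i <;> fin_cases j <;>
      simp [P, Q, X1, Matrix.mul_apply, Matrix.vecMul_diagonal, Fin.sum_univ_two] <;> ring
  change NormedSpace.exp (s • X1).1 = _
  rw [h2, h1, boost_coe, Matrix.exp_diagonal]
  change P * Matrix.diagonal _ * Q = _
  ext i j; fin_cases i <;> fin_cases j <;>
    simp [P, Q, Matrix.mul_apply, Matrix.vecMul_diagonal, Fin.sum_univ_two, Pi.coe_exp,
      ← Complex.exp_eq_exp_ℂ, Complex.cosh, Complex.sinh] <;> ring

lemma hasDerivAt_boostRow (r : ℝ) :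
    HasDerivAt (fun s : ℝ => boostRow (s • r)) (-r • unit 1) 0 := by
  have h0 : HasDerivAt (fun s : ℝ => s • r) r 0 := by
    simpa using (hasDerivAt_id (0 : ℝ)).smul_const r
  have h1 := ((Real.hasDerivAt_cosh _).comp (0 : ℝ) h0).ofReal_comp
  have h2 := ((Real.hasDerivAt_sinh _).comp (0 : ℝ) h0).ofReal_comp.neg
  refine (h1.prodMk h2).congr_deriv ?_
  simp [unit]

/-- Differentiation at `s = 0` recovers `X` from its one-parameter group. This identifies the
isotropy algebra; the case `r = 0` gives the trivial one for `SU(1,1)` alone. -/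
lemma expL_eq_boost_iff (X : su11) (r : ℝ) :
    (∀ s : ℝ, expL (s • X) = boost (-(s • r))) ↔ X = r • X1 := by
  constructor
  · intro h
    have h1 := hasDerivAt_coordL_expL X
    have h2 := hasDerivAt_boostRow (-r)
    simp only [h, coordL_boost, ← smul_neg] at h1
    refine su11_ext ((h1.unique h2).trans ?_)
    simp [row, unit, X1]
  · rintro rfl s
    rw [smul_smul, expL_smul_X1]; rfl

/-! ### Fundamental fields -/

lemma fundamental_expR (ξ : su11 × ℝ) (p : H31) :
    fundamental expR ξ p = mulL (row ξ.1.1) p - ξ.2 • mulL p (unit 1) := by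
  have h1 := mulL.hasFDerivAt.comp_hasDerivAt (0 : ℝ) (hasDerivAt_coordL_expL ξ.1)
  have h2 := h1.clm_apply (hasDerivAt_const (0 : ℝ) (p : ℂ × ℂ))
  have h3 := (mulL.hasFDerivAt.comp_hasDerivAt (0 : ℝ) h2).clm_apply (hasDerivAt_boostRow ξ.2)
  have e : ∀ s : ℝ, ((expR (s • ξ) • p : H31) : ℂ × ℂ)
      = mulL (mulL (coordL (expL (s • ξ.1))) p) (boostRow (s • ξ.2)) := fun s => coe_smul _ p
  have h0 : coordL (expL 0) = (1, 0) := by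
    have h := expL_smul_X1 0
    rw [zero_smul] at h
    rw [h, neg_zero, coordL_boost, boostRow_zero]
  simp only [fundamental, e]
  refine h3.deriv.trans ?_
  simp [h0, boostRow_zero, one_mulL, mulL_one, sub_eq_add_neg]

lemma fundamental_expL_eq (X : su11) (p : H31) :
    fundamental expL X p = fundamental expR (X, (0 : ℝ)) p := by
  have e : ∀ s : ℝ, expL (s • X) • p = expR (s • (X, (0 : ℝ))) • p := fun s => by
    rw [left_smul_eq]
    change _ = ((expL (s • X), Multiplicative.ofAdd (s • (0 : ℝ))) : SU11R) • p
    rw [smul_zero]; rfl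
  simp only [fundamental, e]

/-- The fundamental vector field of an element of `su(1,1) ⊕ ℝ`. -/
def fundField (ξ : su11 × ℝ) : VecField :=
  ⟨fundamental expR ξ, isSmooth_linear (mulL (row ξ.1.1) - ξ.2 • mulL.flip (unit 1)) fun q => by
      rw [fundamental_expR]; simp,
    fun p => by
      have h1 : mulL (row ξ.1.1) p ∈ tangent p := by
        change ambientForm _ _ = 0
        have h := row_re ξ.1
        rw [ambientForm_eq]
        simp [mulL_apply, h]; ring
      rw [fundamental_expR]
      exact sub_mem h1 (Submodule.smul_mem _ _ (mulL_mem_tangent p (unit_re 1)))⟩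

/-- This is `diff_vecField` solved for the coefficient derivatives, so that for fundamental fields,
which are restrictions of linear maps, they can be computed without differentiating `comp`. -/
lemma der_comp (a : Fin 3) (V W : VecField) (p : H31) : (der V (comp a W)).1 p =
    θ a p (diff W.1 p (V.1 p) - mulL (V.1 p) (mulL (conjInv p) (W.1 p))) := by
  rw [diff_vecField W p (V.2.2 p), add_sub_cancel_right]
  simp only [θ_add, θ_smul, θ_mulL, imCoord_unit]
  change diff (comp a W).1 p (V.1 p) = _
  fin_cases a <;> simp

lemma fundField_base (ξ : su11 × ℝ) : (fundField ξ).1 base =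
    (⟨0, suCoord 0 ξ.1⟩, ⟨suCoord 1 ξ.1 - ξ.2, suCoord 2 ξ.1⟩) := by
  change fundamental expR ξ base = _
  rw [fundamental_expR, row_eq]
  change mulL _ (1, 0) - _ • mulL (1, 0) _ = _
  rw [mulL_one, one_mulL]
  ext1 <;> apply Complex.ext <;> simp [unit]

lemma mulL_conjInv_base (v : ℂ × ℂ) : mulL (conjInv base) v = v := by
  have h : conjInv base = (1, 0) := by simp [conjInv, base]
  rw [h, one_mulL]

/-- With `ξ = (X, r)` and `η = (Y, s)`, the derivative of the components gives `-[X - r X1, Y]`, and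
`r [X1, Y] = -2r B Y`. The connection form adds `κ (x₁ - r) B Y`. The hypothesis, which is the
equation of the complement, makes the two multiples of `B Y` cancel. -/
lemma canonD_fundField {α τ : ℝ} {ξ : su11 × ℝ} (η : su11 × ℝ)
    (hξ : 2 * ξ.2 = (α + τ - 2) * (suCoord 1 ξ.1 - ξ.2)) :
    (canonD α τ (fundField ξ) (fundField η)).1 base = -row (⁅ξ.1, η.1⁆ : su11).1 := by
  have hd : diff (fundField η).1 base ((fundField ξ).1 base)
      = mulL (row η.1.1) ((fundField ξ).1 base)
        - η.2 • mulL ((fundField ξ).1 base) (unit 1) := by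
    rw [diff_linear (mulL (row η.1.1) - η.2 • mulL.flip (unit 1)) (fun q => ?_) base
      ((fundField ξ).2.2 base)]
    · simp
    · change fundamental expR η q = _
      rw [fundamental_expR]; simp
  have hder : ∀ a, (der (fundField ξ) (comp a (fundField η))).1 base = _ := fun a =>
    (der_comp a _ _ base).trans (by rw [hd, θ_eq, mulL_conjInv_base, mulL_conjInv_base])
  have hc : ∀ (a : Fin 3) (ζ : su11 × ℝ), (comp a (fundField ζ)).1 base
      = imCoord a ((fundField ζ).1 base) := fun a ζ => by
    rw [comp_apply, θ_eq, mulL_conjInv_base]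
  obtain ⟨a0, a1, a2⟩ := comp_canonD α τ (fundField ξ) (fundField η)
  have b0 : _ = (der (fundField ξ) (comp 0 (fundField η))).1 base + (α + τ - 2)
      * ((comp 1 (fundField ξ)).1 base * (comp 2 (fundField η)).1 base) :=
    congrArg (fun f : SmoothFun => f.1 base) a0
  have b1 : _ = (der (fundField ξ) (comp 1 (fundField η))).1 base :=
    congrArg (fun f : SmoothFun => f.1 base) a1
  have b2 : _ = (der (fundField ξ) (comp 2 (fundField η))).1 base + (α + τ - 2)
      * ((comp 1 (fundField ξ)).1 base * (comp 0 (fundField η)).1 base) :=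
    congrArg (fun f : SmoothFun => f.1 base) a2
  rw [hder, hc, hc, fundField_base, fundField_base, row_eq] at b0 b2
  rw [hder, fundField_base, fundField_base, row_eq] at b1
  obtain ⟨l0, l1, l2⟩ := suCoord_lie ξ.1 η.1
  have hmem : -row (⁅ξ.1, η.1⁆ : su11).1 ∈ tangent base := by
    have h := mulL_mem_tangent base (row_re ⁅ξ.1, η.1⁆)
    change mulL (1, 0) _ ∈ _ at h
    rw [one_mulL] at h
    exact neg_mem h
  refine tangent_ext ((canonD α τ (fundField ξ) (fundField η)).2.2 base) hmem fun a => ?_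
  have hr : θ a base (-row (⁅ξ.1, η.1⁆ : su11).1) = -suCoord a ⁅ξ.1, η.1⁆ := by
    have h := θ_smul a base (-1) (row (⁅ξ.1, η.1⁆ : su11).1)
    rw [neg_one_smul] at h
    rw [h, θ_eq, mulL_conjInv_base, suCoord_apply]; ring
  rw [hr]
  fin_cases a
  · refine b0.trans ?_
    change _ = -suCoord 0 ⁅ξ.1, η.1⁆
    rw [l0]
    simp [imCoord, mulL_apply, unit]
    linear_combination -suCoord 2 η.1 * hξ
  · refine b1.trans ?_
    change _ = -suCoord 1 ⁅ξ.1, η.1⁆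
    rw [l1]
    simp [imCoord, mulL_apply, unit]
    ring
  · refine b2.trans ?_
    change _ = -suCoord 2 ⁅ξ.1, η.1⁆
    rw [l2]
    simp [imCoord, mulL_apply, unit]
    linear_combination -suCoord 0 η.1 * hξ

/-! ### The reductive decompositions -/

lemma mem_isotropy_iff (ξ : su11 × ℝ) : ξ ∈ isotropy ↔ ξ.1 = ξ.2 • X1 := by
  rw [isotropy, Submodule.mem_span_singleton]
  constructor
  · rintro ⟨c, rfl⟩
    simp [inc, D]
  · intro h
    refine ⟨ξ.2, Prod.ext ?_ ?_⟩
    · rw [h]; simp [inc, D]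
    · simp [inc, D]

/-- Here `suCoord 1 ξ.1 - ξ.2` is the `θ¹`-component of `ξ*` at `o`, so the complement lifts a
tangent vector by giving it the `D`-component `κ/2` times its `θ¹`-component. -/
lemma mem_complement_iff {mu nu t : ℝ} (hnu : nu ≠ 0) (ξ : su11 × ℝ) :
    ξ ∈ complement mu nu t ↔ 2 * ξ.2 = (mu / nu + t / nu - 2) * (suCoord 1 ξ.1 - ξ.2) := by
  obtain ⟨p0, p1, p2⟩ := suCoord_X0
  obtain ⟨q0, q1, q2⟩ := suCoord_X1
  obtain ⟨r0, r1, r2⟩ := suCoord_X2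
  rw [complement, Submodule.mem_span_triple]
  constructor
  · rintro ⟨a, b, c, rfl⟩
    simp [inc, D, p1, q1, r1]
    field_simp
    ring
  · intro h
    -- The coefficients are the coordinates of `ξ*` at `o`, since the three generators evaluate
    -- there to the frame.
    refine ⟨suCoord 0 ξ.1, suCoord 1 ξ.1 - ξ.2, suCoord 2 ξ.1, Prod.ext ?_ ?_⟩
    · refine su11_ext_coord ?_ ?_ ?_
      · simp [inc, D, p0, q0, r0]
      · simp [inc, D, p1, q1, r1]
        field_simp at h ⊢
        linear_combination -h
      · simp [inc, D, p2, q2, r2]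
    · simp [inc, D]
      field_simp at h ⊢
      linear_combination -h

lemma isReductiveDecomposition {mu nu t : ℝ} (hnu : nu ≠ 0) :
    IsReductiveDecomposition expR AdR base isotropy (complement mu nu t) := by
  obtain ⟨q0, q1, q2⟩ := suCoord_X1
  refine ⟨fun ξ => ?_, ?_, fun γ hγ ξ hξ => ?_⟩
  · rw [mem_isotropy_iff, ← expL_eq_boost_iff]
    exact forall_congr' fun s => (mem_stabilizer_iff (expR (s • ξ))).symm
  · constructor
    · rw [Submodule.disjoint_def]
      intro ξ h1 h2
      rw [mem_isotropy_iff] at h1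
      rw [mem_complement_iff hnu, h1, map_smul, q1, smul_eq_mul, mul_one, sub_self, mul_zero] at h2
      have h3 : ξ.2 = 0 := by linarith
      rw [h3, zero_smul] at h1
      exact Prod.ext h1 h3
    · rw [codisjoint_iff, eq_top_iff]
      intro ξ _
      -- Subtracting `c (X1 + D)` leaves `suCoord 1 ξ.1 - ξ.2` unchanged and lowers `ξ.2` by `c`;
      -- this value makes the equation of the complement hold.
      let c := ξ.2 - (mu / nu + t / nu - 2) * (suCoord 1 ξ.1 - ξ.2) / 2
      refine Submodule.mem_sup.2 ⟨(c • X1, c), (mem_isotropy_iff _).2 rfl,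
        ξ - (c • X1, c), (mem_complement_iff hnu _).2 ?_, add_sub_cancel _ _⟩
      simp only [Prod.fst_sub, Prod.snd_sub, map_sub, map_smul, q1, smul_eq_mul, c]
      ring
  · rw [mem_stabilizer_iff] at hγ
    rw [mem_complement_iff hnu] at hξ ⊢
    -- The isotropy acts by conjugation with boosts, which fixes the `X1`-coordinate. The
    -- `D`-coordinate is fixed as well, and the equation of the complement involves only these two.
    have h : suCoord 1 (AdR γ ξ).1 = suCoord 1 ξ.1 := by
      have hc : boostRow (-γ.2.toAdd) = conjInv (boostRow γ.2.toAdd) := by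
        simp [boostRow, conjInv, -Complex.ofReal_cosh, -Complex.ofReal_sinh]
      have e : row (AdR γ ξ).1.1 = mulL (mulL (boostRow (-γ.2.toAdd)) (row ξ.1.1))
          (boostRow γ.2.toAdd) := by
        change row (γ.1.1.1 * ξ.1.1 * (γ.1⁻¹).1.1) = _
        rw [hγ, ← boost_neg, neg_neg, ← toMat_coordL, ← toMat_coordL, ← toMat_row ξ.1,
          ← toMat_mulL, ← toMat_mulL, row_toMat, coordL_boost, coordL_boost, toMat_row]
      rw [suCoord_apply, e, hc, boost_conj]; rfl
    rw [h]; exact hξ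

lemma isReductiveDecomposition_left : IsReductiveDecomposition expL AdL base ⊥ ⊤ := by
  refine ⟨fun X => ?_, isCompl_bot_top, fun _ _ _ _ => Submodule.mem_top⟩
  have h := expL_eq_boost_iff X 0
  simp only [smul_zero, zero_smul, neg_zero, boost_zero] at h
  rw [Submodule.mem_bot, ← h]
  exact forall_congr' fun s => (mem_stabilizer_left_iff _).symm

/-- Fundamental fields of `h` vanish at `o`, so the `m`-component of `[ξ, η]` has the same value at
`o` as `[ξ, η]` itself, which has no `D`-component. -/
lemma isCanonicalConnection {mu nu t : ℝ} (hnu : nu ≠ 0) :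
    IsCanonicalConnection expR base isotropy (complement mu nu t)
      (canonD (mu / nu) (t / nu)) := by
  refine ⟨canonD_pushesTo _ _, fun ξ hξ η _ =>
    ⟨fundField ξ, fundField η, rfl, rfl, fun ζ _ h => ?_⟩⟩
  obtain ⟨q0, q1, q2⟩ := suCoord_X1
  rw [canonD_fundField η ((mem_complement_iff hnu ξ).1 hξ)]
  rw [mem_isotropy_iff] at h
  have h1 : ⁅ξ.1, η.1⁆ - ζ.1 = (⁅ξ.2, η.2⁆ - ζ.2) • X1 := h
  -- The bracket of the central real components vanishes.
  rw [Ring.lie_def, mul_comm, sub_self, zero_sub] at h1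
  have h2 : ⁅ξ.1, η.1⁆ = ζ.1 - ζ.2 • X1 := by rw [← sub_add_cancel ⁅ξ.1, η.1⁆ ζ.1, h1]; module
  change _ = -(fundField ζ).1 base
  rw [h2, fundField_base, row_eq]
  simp [q0, q1, q2]

lemma isCanonicalConnection_left {α τ : ℝ} (h : α + τ - 2 = 0) :
    IsCanonicalConnection expL base ⊥ ⊤ (canonD α τ) := by
  refine ⟨canonD_pushesTo_left _ _, fun ξ _ η _ =>
    ⟨fundField (ξ, 0), fundField (η, 0), funext fun p => (fundamental_expL_eq ξ p).symm,
      funext fun p => (fundamental_expL_eq η p).symm, fun ζ _ hζ => ?_⟩⟩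
  rw [Submodule.mem_bot, sub_eq_zero] at hζ
  rw [canonD_fundField (η, 0) (by rw [h]; simp), hζ, fundamental_expL_eq]
  change _ = -(fundField (ζ, 0)).1 base
  rw [fundField_base, row_eq]; simp

/-! ### The holonomy algebra and the structure algebra -/

/-- The coordinates of a tangent vector at the base point. -/
def tCoord (a : Fin 3) : tangent base →ₗ[ℝ] ℝ where
  toFun x := θ a base x
  map_add' x y := θ_add a base x y
  map_smul' c x := θ_smul a base c x

/-- The frame at the base point. -/
def tFrame (a : Fin 3) : tangent base := valueAt base (frame a)

lemma tCoord_tFrame (a b : Fin 3) : tCoord a (tFrame b) = if a = b then 1 else 0 := by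
  change θ a base (mulL base (unit b)) = _
  rw [θ_mulL, imCoord_unit]

lemma tCoord_valueAt (a : Fin 3) (V : VecField) : tCoord a (valueAt base V) = (comp a V).1 base :=
  rfl

lemma tangent_base_ext {x y : tangent base} (h0 : tCoord 0 x = tCoord 0 y)
    (h1 : tCoord 1 x = tCoord 1 y) (h2 : tCoord 2 x = tCoord 2 y) : x = y :=
  Subtype.ext (tangent_ext x.2 y.2 fun a => by fin_cases a <;> assumption)

lemma coe_tangent_base (x : tangent base) :
    (x : ℂ × ℂ) = (⟨0, tCoord 0 x⟩, ⟨tCoord 1 x, tCoord 2 x⟩) := by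
  have h1 := re_of_mem_tangent x.2
  have h2 : ∀ a, tCoord a x = imCoord a (x : ℂ × ℂ) := fun a => by
    change θ a base x = _
    rw [θ_eq, mulL_conjInv_base]
  rw [mulL_conjInv_base] at h1
  rw [h2, h2, h2]
  ext1
  · exact Complex.ext h1 rfl
  · rfl

/-- The tangent vector at the base point with given coordinates. -/
def tMk (c : Fin 3 → ℝ) : tangent base := c 0 • tFrame 0 + c 1 • tFrame 1 + c 2 • tFrame 2

lemma tCoord_tMk (a : Fin 3) (c : Fin 3 → ℝ) : tCoord a (tMk c) = c a := by
  simp only [tMk, map_add, map_smul, tCoord_tFrame]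
  fin_cases a <;> simp

lemma exists_valueAt (x : tangent base) : ∃ Z : VecField, valueAt base Z = x := by
  refine ⟨ofComp fun a => algebraMap ℝ SmoothFun (tCoord a x), ?_⟩
  have h : ∀ a, tCoord a (valueAt base (ofComp fun a => algebraMap ℝ SmoothFun (tCoord a x)))
      = tCoord a x := fun a => by rw [tCoord_valueAt, comp_ofComp]; rfl
  exact tangent_base_ext (h 0) (h 1) (h 2)

/-- The infinitesimal boost of the tangent space in the plane of `X0` and `X2`. -/
def boostGen : Module.End ℝ (tangent base) :=
  (tCoord 2).smulRight (tFrame 0) + (tCoord 0).smulRight (tFrame 2)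

lemma tCoord_boostGen (x : tangent base) : tCoord 0 (boostGen x) = tCoord 2 x ∧
    tCoord 1 (boostGen x) = 0 ∧ tCoord 2 (boostGen x) = tCoord 0 x := by
  simp [boostGen, tCoord_tFrame]

/-- The curvature of the canonical connection at the base point. -/
def curvEnd (α τ : ℝ) (X Y : VecField) : Module.End ℝ (tangent base) :=
  (-2 * ((comp 2 X).1 base * (comp 0 Y).1 base - (comp 0 X).1 base * (comp 2 Y).1 base))
    • (α + τ - 2) • boostGen

lemma isCurvatureAt_curvEnd (α τ : ℝ) (X Y : VecField) :
    IsCurvatureAt (canonD α τ) base X Y (curvEnd α τ X Y) := fun Z => by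
  obtain ⟨a0, a1, a2⟩ := comp_curvature_canonD α τ X Y Z
  obtain ⟨b0, b1, b2⟩ := tCoord_boostGen (valueAt base Z)
  refine tangent_base_ext ?_ ?_ ?_
  · rw [tCoord_valueAt, a0, curvEnd]
    simp only [LinearMap.smul_apply, map_smul, b0, smul_eq_mul, tCoord_valueAt]
    change _ = -2 * (α + τ - 2) * ((comp 2 X).1 base * (comp 0 Y).1 base
      - (comp 0 X).1 base * (comp 2 Y).1 base) * (comp 2 Z).1 base
    ring
  · rw [tCoord_valueAt, a1, curvEnd]
    simp only [LinearMap.smul_apply, map_smul, b1, smul_zero]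
    rfl
  · rw [tCoord_valueAt, a2, curvEnd]
    simp only [LinearMap.smul_apply, map_smul, b2, smul_eq_mul, tCoord_valueAt]
    change _ = -2 * (α + τ - 2) * ((comp 2 X).1 base * (comp 0 Y).1 base
      - (comp 0 X).1 base * (comp 2 Y).1 base) * (comp 0 Z).1 base
    ring

/-- Uniqueness holds because every tangent vector at `o` is the value of a vector field. -/
lemma isCurvatureAt_iff (α τ : ℝ) (X Y : VecField) (u : Module.End ℝ (tangent base)) :
    IsCurvatureAt (canonD α τ) base X Y u ↔ u = curvEnd α τ X Y := by
  refine ⟨fun h => LinearMap.ext fun x => ?_, fun h => h ▸ isCurvatureAt_curvEnd α τ X Y⟩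
  obtain ⟨Z, rfl⟩ := exists_valueAt x
  rw [h, isCurvatureAt_curvEnd]

lemma lie_smul_smul_self (r s : ℝ) (u : Module.End ℝ (tangent base)) :
    ⁅r • u, s • u⁆ = 0 := by
  change (r • u) * (s • u) - (s • u) * (r • u) = 0
  rw [smul_mul_smul_comm, smul_mul_smul_comm, mul_comm]
  exact sub_self (G := Module.End ℝ (tangent base)) _

/-- All curvature operators are multiples of `κ B`, so their span is abelian and already a Lie
algebra. Keeping the factor `κ` covers the flat case too. -/
lemma mem_holonomy_iff (α τ : ℝ) (u : Module.End ℝ (tangent base)) :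
    u ∈ holonomy (canonD α τ) base ↔ ∃ r : ℝ, u = r • (α + τ - 2) • boostGen := by
  constructor
  · intro hu
    let K : LieSubalgebra ℝ (Module.End ℝ (tangent base)) :=
      { Submodule.span ℝ {(α + τ - 2) • boostGen} with
        lie_mem' := by
          intro x y hx hy
          obtain ⟨r, rfl⟩ := Submodule.mem_span_singleton.1 hx
          obtain ⟨s, rfl⟩ := Submodule.mem_span_singleton.1 hy
          have h : ⁅r • (α + τ - 2) • boostGen, s • (α + τ - 2) • boostGen⁆ = 0 := by
            exact lie_smul_smul_self _ _ _
          change _ ∈ Submodule.span ℝ _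
          rw [h]
          exact zero_mem _ }
    have hK : holonomy (canonD α τ) base ≤ K := by
      refine LieSubalgebra.lieSpan_le.2 ?_
      rintro v ⟨X, Y, h⟩
      rw [isCurvatureAt_iff] at h
      exact Submodule.mem_span_singleton.2 ⟨_, h.symm⟩
    obtain ⟨r, h⟩ := Submodule.mem_span_singleton.1 (hK hu)
    exact ⟨r, h.symm⟩
  · rintro ⟨r, rfl⟩
    have h : curvEnd α τ (frame 2) (frame 0) ∈ holonomy (canonD α τ) base :=
      LieSubalgebra.subset_lieSpan ⟨_, _, isCurvatureAt_curvEnd α τ _ _⟩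
    have e : curvEnd α τ (frame 2) (frame 0) = (-2 : ℝ) • (α + τ - 2) • boostGen := by
      have hc : ∀ a b, (comp a (frame b)).1 base = if a = b then 1 else 0 := fun a b => by
        rw [← tCoord_valueAt]; exact tCoord_tFrame a b
      simp [curvEnd, hc]
    -- The curvature operator of `X2` and `X0` is `-2 κ B`, hence the factor `-r/2`.
    have h2 := (holonomy (canonD α τ) base).smul_mem (-r / 2) h
    rw [e, smul_smul] at h2
    convert h2 using 2
    ring

/-! ### Identification of the structure algebra with `su(1,1) ⊕ ℝ`. -/

/-- The element of `su(1,1)` with the coordinates of a tangent vector at the base point. -/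
def toSu : tangent base →ₗ[ℝ] su11 :=
  (tCoord 0).smulRight X0 + (tCoord 1).smulRight X1 + (tCoord 2).smulRight X2

lemma suCoord_toSu (a : Fin 3) (x : tangent base) : suCoord a (toSu x) = tCoord a x := by
  obtain ⟨p0, p1, p2⟩ := suCoord_X0
  obtain ⟨q0, q1, q2⟩ := suCoord_X1
  obtain ⟨r0, r1, r2⟩ := suCoord_X2
  fin_cases a <;> simp [toSu, p0, p1, p2, q0, q1, q2, r0, r1, r2]

/-- The coefficient of a multiple of `boostGen`. -/
def boostCoeff : Module.End ℝ (tangent base) →ₗ[ℝ] ℝ :=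
  tCoord 2 ∘ₗ LinearMap.applyₗ (tFrame 0)

lemma boostCoeff_boostGen : boostCoeff boostGen = 1 := by
  change tCoord 2 (boostGen (tFrame 0)) = 1
  rw [(tCoord_boostGen _).2.2, tCoord_tFrame]; rfl

lemma eq_boostCoeff_smul {α τ : ℝ} (U : holonomy (canonD α τ) base) :
    U.1 = boostCoeff U.1 • boostGen := by
  obtain ⟨r, h⟩ := (mem_holonomy_iff α τ U.1).1 U.2
  rw [h, map_smul, map_smul, boostCoeff_boostGen]
  module

lemma holonomy_lie {α τ : ℝ} (U V : holonomy (canonD α τ) base) : ⁅U, V⁆ = 0 := by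
  apply Subtype.ext
  rw [LieSubalgebra.coe_bracket, eq_boostCoeff_smul U, eq_boostCoeff_smul V]
  exact lie_smul_smul_self _ _ _

/-- The linear map of `hol ⊕ T_o` to `su(1,1) ⊕ ℝ` which defines the identification of the
structure algebra, with `κ = α + τ - 2`. -/
def structureMap (κ : ℝ) : (Module.End ℝ (tangent base) × tangent base) →ₗ[ℝ] su11 × ℝ :=
  (boostCoeff.smulRight ((-1 / 2 : ℝ) • (inc X1 + D))).coprod
    ((LinearMap.inl ℝ su11 ℝ).comp toSu + (tCoord 1).smulRight ((κ / 2) • (inc X1 + D)))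

/-- The factor `-1/2` is forced by `ad X1 = -2B`. The correction `κ/2 · (X1 + D)` moves the lift of
`x` into the complement without changing its value at `o`. -/
lemma structureMap_fst (κ : ℝ) (U : Module.End ℝ (tangent base)) (x : tangent base) :
    suCoord 0 (structureMap κ (U, x)).1 = tCoord 0 x ∧
    suCoord 1 (structureMap κ (U, x)).1
      = -boostCoeff U / 2 + (1 + κ / 2) * tCoord 1 x ∧
    suCoord 2 (structureMap κ (U, x)).1 = tCoord 2 x ∧
    (structureMap κ (U, x)).2 = -boostCoeff U / 2 + κ / 2 * tCoord 1 x := by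
  obtain ⟨q0, q1, q2⟩ := suCoord_X1
  simp [structureMap, inc, D, suCoord_toSu, q0, q1, q2]
  constructor <;> ring

lemma su11R_ext {ξ η : su11 × ℝ} (h0 : suCoord 0 ξ.1 = suCoord 0 η.1)
    (h1 : suCoord 1 ξ.1 = suCoord 1 η.1) (h2 : suCoord 2 ξ.1 = suCoord 2 η.1)
    (h : ξ.2 = η.2) : ξ = η := Prod.ext (su11_ext_coord h0 h1 h2) h

/-- This is minus the torsion of the canonical connection; antisymmetrisation leaves only the sum `α
+ τ`. -/
lemma comp_str_base (α τ : ℝ) (X Y : VecField) :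
    tCoord 0 (valueAt base (strTensor α τ X Y - strTensor α τ Y X)) =
      (α + τ) * (tCoord 2 (valueAt base X) * tCoord 1 (valueAt base Y)
        - tCoord 1 (valueAt base X) * tCoord 2 (valueAt base Y)) ∧
    tCoord 1 (valueAt base (strTensor α τ X Y - strTensor α τ Y X)) =
      2 * (tCoord 2 (valueAt base X) * tCoord 0 (valueAt base Y)
        - tCoord 0 (valueAt base X) * tCoord 2 (valueAt base Y)) ∧
    tCoord 2 (valueAt base (strTensor α τ X Y - strTensor α τ Y X)) =
      (α + τ) * (tCoord 0 (valueAt base X) * tCoord 1 (valueAt base Y)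
        - tCoord 1 (valueAt base X) * tCoord 0 (valueAt base Y)) := by
  obtain ⟨a0, a1, a2⟩ := comp_strField α τ X Y
  obtain ⟨b0, b1, b2⟩ := comp_strField α τ Y X
  have h : ∀ a, comp a (strTensor α τ X Y - strTensor α τ Y X)
    = comp a (strField α τ X Y) - comp a (strField α τ Y X) := fun a => comp_sub a _ _
  simp only [tCoord_valueAt, h, a0, a1, a2, b0, b1, b2]
  refine ⟨?_, ?_, ?_⟩
  · change (α * ((comp 2 X).1 base * (comp 1 Y).1 base) - τ * ((comp 1 X).1 base * (comp 2 Y).1 base))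
      - (α * ((comp 2 Y).1 base * (comp 1 X).1 base) - τ * ((comp 1 Y).1 base * (comp 2 X).1 base))
      = _
    ring
  · change ((comp 2 X).1 base * (comp 0 Y).1 base - (comp 0 X).1 base * (comp 2 Y).1 base)
      - ((comp 2 Y).1 base * (comp 0 X).1 base - (comp 0 Y).1 base * (comp 2 X).1 base) = _
    ring
  · change (α * ((comp 0 X).1 base * (comp 1 Y).1 base) - τ * ((comp 1 X).1 base * (comp 0 Y).1 base))
      - (α * ((comp 0 Y).1 base * (comp 1 X).1 base) - τ * ((comp 1 Y).1 base * (comp 0 X).1 base))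
      = _
    ring

/-- The restriction of `structureMap` to `hol ⊕ T_o`. -/
def holMap (α τ : ℝ) : (holonomy (canonD α τ) base × tangent base) →ₗ[ℝ] su11 × ℝ :=
  (structureMap (α + τ - 2)).comp
    (LinearMap.prodMap (holonomy (canonD α τ) base).toSubmodule.subtype LinearMap.id)

section

variable {α τ : ℝ}

lemma holMap_coord (U : holonomy (canonD α τ) base) (x : tangent base) :
    suCoord 0 (holMap α τ (U, x)).1 = tCoord 0 x ∧
    suCoord 1 (holMap α τ (U, x)).1
      = -boostCoeff U.1 / 2 + (1 + (α + τ - 2) / 2) * tCoord 1 x ∧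
    suCoord 2 (holMap α τ (U, x)).1 = tCoord 2 x ∧
    (holMap α τ (U, x)).2 = -boostCoeff U.1 / 2 + (α + τ - 2) / 2 * tCoord 1 x :=
  structureMap_fst (α + τ - 2) U.1 x

lemma holMap_inl (U : holonomy (canonD α τ) base) :
    suCoord 0 (holMap α τ (U, 0)).1 = 0 ∧
    suCoord 1 (holMap α τ (U, 0)).1 = -boostCoeff U.1 / 2 ∧
    suCoord 2 (holMap α τ (U, 0)).1 = 0 ∧
    (holMap α τ (U, 0)).2 = -boostCoeff U.1 / 2 := by
  obtain ⟨f0, f1, f2, f3⟩ := holMap_coord U 0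
  simp only [map_zero, mul_zero, add_zero] at f0 f1 f2 f3
  exact ⟨f0, f1, f2, f3⟩

lemma holMap_inr (x : tangent base) :
    suCoord 0 (holMap α τ (0, x)).1 = tCoord 0 x ∧
    suCoord 1 (holMap α τ (0, x)).1 = (1 + (α + τ - 2) / 2) * tCoord 1 x ∧
    suCoord 2 (holMap α τ (0, x)).1 = tCoord 2 x ∧
    (holMap α τ (0, x)).2 = (α + τ - 2) / 2 * tCoord 1 x := by
  obtain ⟨f0, f1, f2, f3⟩ := holMap_coord (0 : holonomy (canonD α τ) base) x
  have z : boostCoeff (0 : holonomy (canonD α τ) base).1 = 0 := map_zero boostCoeff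
  rw [z, neg_zero, zero_div, zero_add] at f1 f3
  exact ⟨f0, f1, f2, f3⟩

lemma exists_boostCoeff (hκ : α + τ - 2 ≠ 0) (r : ℝ) :
    ∃ U : holonomy (canonD α τ) base, boostCoeff U.1 = r :=
  ⟨⟨r • boostGen, (mem_holonomy_iff α τ _).2
    ⟨r / (α + τ - 2), by rw [smul_smul, div_mul_cancel₀ _ hκ]⟩⟩, by
      change boostCoeff (r • boostGen) = r
      rw [map_smul, boostCoeff_boostGen, smul_eq_mul, mul_one]⟩

lemma holMap_injective : Function.Injective (holMap α τ) := by
  rw [injective_iff_map_eq_zero]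
  rintro ⟨U, x⟩ h
  obtain ⟨f0, f1, f2, f3⟩ := holMap_coord U x
  rw [h] at f0 f1 f2 f3
  simp only [Prod.fst_zero, Prod.snd_zero, map_zero] at f0 f1 f2 f3
  -- The `X1`-coordinate minus the `D`-coordinate of the image is `tCoord 1 x`, since the multiples
  -- of `X1 + D` drop out.
  have hx : tCoord 1 x = 0 := by linarith
  rw [hx] at f3
  have hU : boostCoeff U.1 = 0 := by linarith
  refine Prod.ext (Subtype.ext ?_) (tangent_base_ext ?_ ?_ ?_)
  · change U.1 = 0
    rw [eq_boostCoeff_smul U, hU, zero_smul]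
  · rw [← f0]; exact (map_zero _).symm
  · rw [hx]; exact (map_zero _).symm
  · rw [← f2]; exact (map_zero _).symm

/-- The condition `κ ≠ 0` enters only here and in `eq_smul_X1_iff`: it makes the holonomy algebra a
full line, so that it can cover `h`. -/
lemma holMap_surjective (hκ : α + τ - 2 ≠ 0) : Function.Surjective (holMap α τ) := fun ξ => by
  obtain ⟨U, hU⟩ := exists_boostCoeff hκ (-2 * ξ.2 + (α + τ - 2) * (suCoord 1 ξ.1 - ξ.2))
  refine ⟨(U, tMk ![suCoord 0 ξ.1, suCoord 1 ξ.1 - ξ.2, suCoord 2 ξ.1]), ?_⟩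
  obtain ⟨f0, f1, f2, f3⟩ := holMap_coord U
      (tMk ![suCoord 0 ξ.1, suCoord 1 ξ.1 - ξ.2, suCoord 2 ξ.1])
  simp only [hU, tCoord_tMk] at f0 f1 f2 f3
  refine su11R_ext f0 (f1.trans ?_) f2 (f3.trans ?_) <;> simp <;> ring

lemma eq_smul_X1_iff (hκ : α + τ - 2 ≠ 0) (ξ : su11 × ℝ) :
    ξ.1 = ξ.2 • X1 ↔ ∃ U, holMap α τ (U, 0) = ξ := by
  obtain ⟨q0, q1, q2⟩ := suCoord_X1
  constructor
  · intro h
    obtain ⟨U, hU⟩ := exists_boostCoeff hκ (-2 * ξ.2)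
    obtain ⟨f0, f1, f2, f3⟩ := holMap_inl U
    refine ⟨U, su11R_ext (f0.trans ?_) (f1.trans ?_) (f2.trans ?_) (f3.trans ?_)⟩ <;>
      simp [h, q0, q1, q2, hU]
  · rintro ⟨U, rfl⟩
    obtain ⟨f0, f1, f2, f3⟩ := holMap_inl U
    refine su11_ext_coord ?_ ?_ ?_ <;> simp [f0, f1, f2, f3, q0, q1, q2]

lemma two_mul_eq_iff (ξ : su11 × ℝ) :
    2 * ξ.2 = (α + τ - 2) * (suCoord 1 ξ.1 - ξ.2) ↔ ∃ x, holMap α τ (0, x) = ξ := by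
  constructor
  · intro h
    obtain ⟨f0, f1, f2, f3⟩ := holMap_inr (α := α) (τ := τ)
      (tMk ![suCoord 0 ξ.1, suCoord 1 ξ.1 - ξ.2, suCoord 2 ξ.1])
    simp only [tCoord_tMk] at f0 f1 f2 f3
    refine ⟨_, su11R_ext f0 (f1.trans ?_) f2 (f3.trans ?_)⟩
    · simp; linear_combination -h / 2
    · simp; linear_combination -h / 2
  · rintro ⟨x, rfl⟩
    obtain ⟨-, f1, -, f3⟩ := holMap_inr (α := α) (τ := τ) x
    rw [f1, f3]
    ring

lemma fundamental_holMap (x : tangent base) :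
    fundamental expR (holMap α τ (0, x)) base = x := by
  obtain ⟨f0, f1, f2, f3⟩ := holMap_inr (α := α) (τ := τ) x
  have h := fundField_base (holMap α τ (0, x))
  change fundamental expR (holMap α τ (0, x)) base = _ at h
  rw [h, coe_tangent_base, f0, f1, f2, f3, ← sub_mul, add_sub_cancel_right, one_mul]

lemma snd_lie (ξ η : su11 × ℝ) : (⁅ξ, η⁆ : su11 × ℝ).2 = 0 := by
  change ⁅ξ.2, η.2⁆ = 0
  rw [Ring.lie_def]; ring

lemma holMap_lie_inl (U V : holonomy (canonD α τ) base) :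
    ⁅holMap α τ (U, 0), holMap α τ (V, 0)⁆ = 0 := by
  obtain ⟨f0, f1, f2, f3⟩ := holMap_inl U
  obtain ⟨g0, g1, g2, g3⟩ := holMap_inl V
  obtain ⟨l0, l1, l2⟩ := suCoord_lie (holMap α τ (U, 0)).1 (holMap α τ (V, 0)).1
  refine su11R_ext (l0.trans ?_) (l1.trans ?_) (l2.trans ?_) (snd_lie _ _)
  · rw [f2, g2]; simp
  · rw [f2, g2]; simp
  · rw [f0, g0]; simp

lemma holMap_lie_inl_inr (U : holonomy (canonD α τ) base) (x : tangent base) :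
    ⁅holMap α τ (U, 0), holMap α τ (0, x)⁆ = holMap α τ (0, U.1 x) := by
  obtain ⟨f0, f1, f2, f3⟩ := holMap_inl U
  obtain ⟨g0, g1, g2, g3⟩ := holMap_inr (α := α) (τ := τ) x
  obtain ⟨k0, k1, k2, k3⟩ := holMap_inr (α := α) (τ := τ) (U.1 x)
  obtain ⟨l0, l1, l2⟩ := suCoord_lie (holMap α τ (U, 0)).1 (holMap α τ (0, x)).1
  obtain ⟨b0, b1, b2⟩ := tCoord_boostGen x
  have hU : U.1 x = boostCoeff U.1 • boostGen x :=
    congrArg (fun u : Module.End ℝ (tangent base) => u x) (eq_boostCoeff_smul U)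
  have c : ∀ a, tCoord a (U.1 x) = boostCoeff U.1 * tCoord a (boostGen x) := fun a => by
    conv_lhs => rw [hU]
    rw [map_smul, smul_eq_mul]
  rw [c, b0] at k0
  rw [c, b1, mul_zero, mul_zero] at k1 k3
  rw [c, b2] at k2
  refine su11R_ext (l0.trans (Eq.trans ?_ k0.symm)) (l1.trans (Eq.trans ?_ k1.symm))
    (l2.trans (Eq.trans ?_ k2.symm)) ((snd_lie _ _).trans k3.symm)
  · rw [f1, f2, g2]; ring
  · rw [f0, f2]; ring
  · rw [f0, f1, g0]; ring

/-- Brackets have no `D`-component, so the multiples of `X1 + D` on the right must cancel. They do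
because the boost coefficient of `-U` is `κ` times the `θ¹`-component of `S_X Y - S_Y X`. -/
lemma holMap_lie_inr (X Y : VecField) (U : holonomy (canonD α τ) base)
    (hU : U.1 = curvEnd α τ X Y) :
    ⁅holMap α τ (0, valueAt base X), holMap α τ (0, valueAt base Y)⁆
      = holMap α τ (-U, valueAt base (strTensor α τ X Y - strTensor α τ Y X)) := by
  have hb : boostCoeff (-U).1 = 2 * (tCoord 2 (valueAt base X) * tCoord 0 (valueAt base Y)
      - tCoord 0 (valueAt base X) * tCoord 2 (valueAt base Y)) * (α + τ - 2) := by
    have hn : boostCoeff (-U).1 = -boostCoeff U.1 := map_neg boostCoeff U.1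
    rw [hn, hU, curvEnd, map_smul, map_smul, boostCoeff_boostGen]
    simp only [smul_eq_mul, tCoord_valueAt]
    ring
  obtain ⟨s0, s1, s2⟩ := comp_str_base α τ X Y
  obtain ⟨f0, f1, f2, f3⟩ := holMap_inr (α := α) (τ := τ) (valueAt base X)
  obtain ⟨g0, g1, g2, g3⟩ := holMap_inr (α := α) (τ := τ) (valueAt base Y)
  obtain ⟨k0, k1, k2, k3⟩ :=
    holMap_coord (-U) (valueAt base (strTensor α τ X Y - strTensor α τ Y X))
  obtain ⟨l0, l1, l2⟩ := suCoord_lie (holMap α τ (0, valueAt base X)).1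
    (holMap α τ (0, valueAt base Y)).1
  rw [hb] at k1 k3
  rw [s0] at k0
  rw [s1] at k1 k3
  rw [s2] at k2
  refine su11R_ext (l0.trans (Eq.trans ?_ k0.symm)) (l1.trans (Eq.trans ?_ k1.symm))
    (l2.trans (Eq.trans ?_ k2.symm)) ((snd_lie _ _).trans (Eq.trans ?_ k3.symm))
  · rw [f1, f2, g1, g2]; ring
  · rw [f0, f2, g0, g2]; ring
  · rw [f0, f1, g0, g1]; ring
  · ring

end

lemma structureAlgebraIs {mu nu t : ℝ} (hnu : nu ≠ 0) (hκ : mu / nu + t / nu - 2 ≠ 0) :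
    StructureAlgebraIs expR base isotropy (complement mu nu t) (lcConn (mu / nu))
      (strTensor (mu / nu) (t / nu)) :=
  ⟨LinearEquiv.ofBijective (holMap (mu / nu) (t / nu))
      ⟨holMap_injective, holMap_surjective hκ⟩,
    fun ξ => (mem_isotropy_iff ξ).trans (eq_smul_X1_iff hκ ξ),
    fun ξ => (mem_complement_iff hnu ξ).trans (two_mul_eq_iff ξ),
    fundamental_holMap,
    fun U V => by
      rw [holonomy_lie]
      exact (holMap_lie_inl U V).trans (map_zero (holMap (mu / nu) (t / nu))).symm,
    holMap_lie_inl_inr,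
    fun X Y => ⟨⟨curvEnd _ _ X Y, LieSubalgebra.subset_lieSpan
        ⟨X, Y, isCurvatureAt_curvEnd _ _ X Y⟩⟩, isCurvatureAt_curvEnd _ _ X Y,
      holMap_lie_inr X Y _ rfl⟩⟩

/-! ### The flat case `α + τ = 2` and the group `SU(1,1)`. -/

/-- The projection of `hol ⊕ T_o` onto `su(1,1)`. -/
def leftMap (α τ : ℝ) : (holonomy (canonD α τ) base × tangent base) →ₗ[ℝ] su11 :=
  toSu.comp (LinearMap.snd ℝ (holonomy (canonD α τ) base) (tangent base))

section

variable {α τ : ℝ}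

lemma suCoord_leftMap (a : Fin 3) (U : holonomy (canonD α τ) base) (x : tangent base) :
    suCoord a (leftMap α τ (U, x)) = tCoord a x := suCoord_toSu a x

lemma leftMap_inl (U : holonomy (canonD α τ) base) : leftMap α τ (U, 0) = 0 := map_zero toSu

lemma leftMap_tMk (X : su11) : leftMap α τ (0, tMk fun a => suCoord a X) = X := by
  refine su11_ext_coord ?_ ?_ ?_ <;> rw [suCoord_leftMap, tCoord_tMk]

lemma holonomy_eq_zero (hκ : α + τ - 2 = 0) (U : holonomy (canonD α τ) base) : U = 0 := by
  obtain ⟨r, h⟩ := (mem_holonomy_iff α τ U.1).1 U.2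
  apply Subtype.ext
  rw [h, hκ, zero_smul, smul_zero]; rfl

lemma leftMap_injective (hκ : α + τ - 2 = 0) : Function.Injective (leftMap α τ) := by
  rintro ⟨U, x⟩ ⟨V, y⟩ h
  refine Prod.ext ((holonomy_eq_zero hκ U).trans (holonomy_eq_zero hκ V).symm)
    (tangent_base_ext ?_ ?_ ?_) <;>
  rw [← suCoord_leftMap _ U, ← suCoord_leftMap _ V, h]

lemma fundamental_leftMap (x : tangent base) :
    fundamental expL (leftMap α τ (0, x)) base = x := by
  have h := fundField_base (leftMap α τ (0, x), 0)
  change fundamental expR (leftMap α τ (0, x), 0) base = _ at h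
  rw [fundamental_expL_eq, h, coe_tangent_base, suCoord_leftMap, suCoord_leftMap,
    suCoord_leftMap, sub_zero]

/-- When `α + τ = 2`, the coefficients of `S_X Y - S_Y X` are the structure constants of `su(1,1)`;
the holonomy component `U` is ignored by the map. -/
lemma leftMap_lie_inr (hκ : α + τ - 2 = 0) (X Y : VecField) (U : holonomy (canonD α τ) base) :
    ⁅leftMap α τ (0, valueAt base X), leftMap α τ (0, valueAt base Y)⁆
      = leftMap α τ (U, valueAt base (strTensor α τ X Y - strTensor α τ Y X)) := by
  obtain ⟨s0, s1, s2⟩ := comp_str_base α τ X Y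
  obtain ⟨l0, l1, l2⟩ := suCoord_lie (leftMap α τ (0, valueAt base X))
    (leftMap α τ (0, valueAt base Y))
  have h2 : α + τ = 2 := by linarith
  simp only [suCoord_leftMap] at l0 l1 l2
  refine su11_ext_coord (l0.trans ?_) (l1.trans ?_) (l2.trans ?_) <;> rw [suCoord_leftMap]
  · rw [s0, h2]; ring
  · rw [s1]
  · rw [s2, h2]

end

lemma structureAlgebraIs_left {α τ : ℝ} (hκ : α + τ - 2 = 0) :
    StructureAlgebraIs expL base ⊥ ⊤ (lcConn α) (strTensor α τ) :=
  ⟨LinearEquiv.ofBijective (leftMap α τ) ⟨leftMap_injective hκ, fun X => ⟨_, leftMap_tMk X⟩⟩,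
    fun _ => ⟨fun h => ⟨0, (leftMap_inl 0).trans ((Submodule.mem_bot ℝ).1 h).symm⟩,
      fun ⟨U, h⟩ => (Submodule.mem_bot ℝ).2 (h.symm.trans (leftMap_inl U))⟩,
    fun X => ⟨fun _ => ⟨_, leftMap_tMk X⟩, fun _ => Submodule.mem_top⟩,
    fundamental_leftMap,
    fun U V => by
      rw [holonomy_lie]
      change ⁅leftMap α τ (U, 0), leftMap α τ (V, 0)⁆ = leftMap α τ (0, 0)
      rw [leftMap_inl, leftMap_inl, leftMap_inl, lie_zero],
    fun U x => by
      rw [holonomy_eq_zero hκ U]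
      change ⁅leftMap α τ (0, 0), leftMap α τ (0, x)⁆ = leftMap α τ (0, 0)
      rw [leftMap_inl, zero_lie],
    fun X Y => ⟨⟨curvEnd _ _ X Y, LieSubalgebra.subset_lieSpan
        ⟨X, Y, isCurvatureAt_curvEnd _ _ X Y⟩⟩, isCurvatureAt_curvEnd _ _ X Y,
      leftMap_lie_inr hκ X Y _⟩⟩

end AdS3

end

theorem mainTheorem5 (lam mu nu : ℝ) (hmu : 0 < mu) (hnu : 0 < nu)
    (h1 : -lam = nu) (h2 : nu ≠ mu) (t : ℝ) :
    ∃ (nabla : AdS3.AffineConnection) (S : AdS3.Tensor12),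
      AdS3.IsLeviCivita (AdS3.kkMetric lam mu nu) nabla ∧
      (∀ (X Y Z : AdS3.VecField) (p : AdS3.H31),
        AdS3.kkMetric lam mu nu p ((S X Y).1 p) (Z.1 p)
          = AdS3.Smu mu t p (X.1 p) (Y.1 p) (Z.1 p)) ∧
      AdS3.IsHomogeneousStructure (AdS3.kkMetric lam mu nu) nabla S ∧
      (t ≠ 2 * nu - mu →
        AdS3.SmoothAction AdS3.coordR ∧
        (∀ γ : AdS3.SU11R, AdS3.ActsByIsometry (AdS3.kkMetric lam mu nu) γ) ∧
        MulAction.IsPretransitive AdS3.SU11R AdS3.H31 ∧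
        FaithfulSMul AdS3.SU11R AdS3.H31 ∧
        AdS3.IsReductiveDecomposition AdS3.expR AdS3.AdR AdS3.base
          AdS3.isotropy (AdS3.complement mu nu t) ∧
        AdS3.IsCanonicalConnection AdS3.expR AdS3.base
          AdS3.isotropy (AdS3.complement mu nu t) (AdS3.canonical nabla S) ∧
        AdS3.StructureAlgebraIs AdS3.expR AdS3.base
          AdS3.isotropy (AdS3.complement mu nu t) nabla S) ∧
      (t = 2 * nu - mu →
        AdS3.SmoothAction AdS3.coordL ∧
        (∀ A : AdS3.SU11, AdS3.ActsByIsometry (AdS3.kkMetric lam mu nu) A) ∧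
        MulAction.IsPretransitive AdS3.SU11 AdS3.H31 ∧
        FaithfulSMul AdS3.SU11 AdS3.H31 ∧
        AdS3.IsReductiveDecomposition AdS3.expL AdS3.AdL AdS3.base ⊥ ⊤ ∧
        AdS3.IsCanonicalConnection AdS3.expL AdS3.base ⊥ ⊤ (AdS3.canonical nabla S) ∧
        AdS3.StructureAlgebraIs AdS3.expL AdS3.base ⊥ ⊤ nabla S) := by
  have hn := hnu.ne'
  -- The two cases of the theorem are therefore `κ ≠ 0` and `κ = 0`.
  have hκ : mu / nu + t / nu - 2 = (t - (2 * nu - mu)) / nu := by field_simp; ring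
  refine ⟨AdS3.lcConn (mu / nu), AdS3.strTensor (mu / nu) (t / nu),
    AdS3.lcConn_isLeviCivita hn h1, AdS3.kkMetric_strField hn h1,
    AdS3.canonD_isHomogeneousStructure h1 _ _, fun ht => ?_, fun ht => ?_⟩
  · have h0 : mu / nu + t / nu - 2 ≠ 0 := by
      rw [hκ]; exact div_ne_zero (sub_ne_zero.2 ht) hn
    exact ⟨AdS3.smoothAction_coordR, AdS3.actsByIsometry h1, AdS3.isPretransitive,
      AdS3.faithfulSMul, AdS3.isReductiveDecomposition hn, AdS3.isCanonicalConnection hn,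
      AdS3.structureAlgebraIs hn h0⟩
  · have h0 : mu / nu + t / nu - 2 = 0 := by rw [hκ, ht, sub_self, zero_div]
    exact ⟨AdS3.smoothAction_coordL, AdS3.actsByIsometry_left h1, AdS3.isPretransitive_left,
      AdS3.faithfulSMul_left, AdS3.isReductiveDecomposition_left,
      AdS3.isCanonicalConnection_left h0, AdS3.structureAlgebraIs_left h0⟩
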